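/- Let $\mathfrak{so}(n)$ denote the orthogonal Lie algebra of skew-symmetric $n\times n$ matrices and $\mathfrak{sp}(m)$ the symplectic Lie algebra of rank $m$, acting on the $2m$-dimensional space $\mathbb{C}^{2m}$ with its standard symplectic form; both are taken either as complex Lie algebras ($\mathfrak{so}(n,\mathbb{C})$ and $\mathfrak{sp}(2m,\mathbb{C})$) or as compact real Lie algebras ($\mathfrak{so}(n,\mathbb{R})$ and $\mathfrak{sp}(2m,\mathbb{C})\cap\mathfrak{u}(2m)$). In both settings the following holds. (i) For every integer $k\ge 3$ there is no embedding of $\mathfrak{so}(2k+1)$ in $\mathfrak{sp}(k+1)$, that is, no injective homomorphism of Lie algebras (over $\mathbb{C}$, respectively over $\mathbb{R}$) $\mathfrak{so}(2k+1)\to\mathfrak{sp}(k+1)$. (ii) For $k=2$ such an embedding exists: there is an isomorphism $\mathfrak{so}(5)\cong\mathfrak{sp}(2)$ (the $4$-dimensional spin representation), and its composition with the standard inclusion $\mathfrak{sp}(2)\subset\mathfrak{sp}(3)$, which extends an operator on $\mathbb{C}^4$ by zero to $\mathbb{C}^6=\mathbb{C}^4\oplus\mathbb{C}^2$, is an injective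 homomorphism of Lie algebras $\mathfrak{so}(5)\to\mathfrak{sp}(3)$. -/

import Mathlib

open Matrix

attribute [local instance 100] LieRing.ofAssociativeRing

/-- The compact real form `sp(m) = sp(2m, ℂ) ∩ u(2m)`, a real Lie algebra of rank `m`: the
skew-Hermitian complex `2m × 2m` matrices in the complex symplectic Lie algebra. -/
def compactSp (m : ℕ) :
    LieSubalgebra ℝ (Matrix (Fin m ⊕ Fin m) (Fin m ⊕ Fin m) ℂ) where
  carrier := {A | A ∈ LieAlgebra.Symplectic.sp (Fin m) ℂ ∧ Aᴴ = -A}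
  zero_mem' := ⟨(LieAlgebra.Symplectic.sp (Fin m) ℂ).zero_mem, by simp⟩
  add_mem' := by
    rintro A B ⟨hA, hA'⟩ ⟨hB, hB'⟩
    refine ⟨(LieAlgebra.Symplectic.sp (Fin m) ℂ).add_mem hA hB, ?_⟩
    rw [conjTranspose_add, hA', hB', neg_add]
  smul_mem' := by
    rintro c A ⟨hA, hA'⟩
    refine ⟨?_, ?_⟩
    · have h := (LieAlgebra.Symplectic.sp (Fin m) ℂ).smul_mem (c : ℂ) hA
      have e : (c : ℂ) • A = c • A := by ext i j; simp
      rwa [e] at h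
    · rw [conjTranspose_smul, hA']; simp
  lie_mem' := by
    rintro A B ⟨hA, hA'⟩ ⟨hB, hB'⟩
    refine ⟨(LieAlgebra.Symplectic.sp (Fin m) ℂ).lie_mem hA hB, ?_⟩
    simp only [Ring.lie_def, conjTranspose_sub, conjTranspose_mul, hA', hB']
    noncomm_ring

/-- The coordinate inclusion of `ℂ^m ⊕ ℂ^m` in `ℂ^(m+1) ⊕ ℂ^(m+1)` as a matrix. -/
def coordIncl (m : ℕ) : Matrix (Fin (m + 1) ⊕ Fin (m + 1)) (Fin m ⊕ Fin m) ℂ :=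
  (1 : Matrix (Fin (m + 1) ⊕ Fin (m + 1)) (Fin (m + 1) ⊕ Fin (m + 1)) ℂ).submatrix id
    (Sum.map Fin.castSucc Fin.castSucc)

/-- Extension by zero of an operator on `ℂ^m ⊕ ℂ^m` to `ℂ^(m+1) ⊕ ℂ^(m+1)`; on symplectic matrices
this is the standard inclusion of `sp(m)` in `sp(m+1)`. -/
def extendByZero {m : ℕ} (A : Matrix (Fin m ⊕ Fin m) (Fin m ⊕ Fin m) ℂ) :
    Matrix (Fin (m + 1) ⊕ Fin (m + 1)) (Fin (m + 1) ⊕ Fin (m + 1)) ℂ :=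
  coordIncl m * A * (coordIncl m)ᵀ

/-! Nonexistence is proved by exponentiating. Only an additive, bracket-preserving map `φ` into
complex symplectic matrices of size `2k+2` is needed, so the complex and the compact case are one
argument. Let `E i j` be the images of the infinitesimal rotations. The automorphisms `s i j =
exp(π/2 · E i j)` of `V = ℂ^(2k+2)` preserve the symplectic form and multiply like lifted quarter
turns (`IsRotationFamily.isQuarterTurnFamily`). All full turns `s i j ^ 4` are one element `z` with
`z ^ 2 = 1` that commutes with every `s i j`, so `V` splits into the eigenspaces `z = 1` and `z =
-1`.

Where `z = -1`, half turns in planes sharing one axis anticommute, as in a Clifford algebra. If this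
eigenspace is nonzero, its dimension is at least `2^k` (`two_pow_le_finrank_of_full_turn`), which
exceeds `2k+2` for `k ≥ 4`. For `k = 3` both numbers are 8, and the symplectic form decides: three
commuting involutions cut out a joint eigenspace of one eighth of the dimension, on which the
alternating form is nondegenerate. It has dimension at least 2, so `dim V ≥ 16`
(`sixteen_le_finrank_of_full_turn`).

Hence `z = 1`. Now the half turns are commuting involutions, permuted by the quarter turns as by
transpositions of the axes. If one is nontrivial, transpositions move a joint eigenvector into at
least `k+2` distinct, mutually orthogonal joint eigenspaces. Each is symplectic, hence of dimension
at least 2, and `2k+4 > 2k+2` (`half_turn_eq_one`). So all half turns are trivial. But conjugation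
by the half turn in the plane `i j` negates `E j l`, so `E j l = 0` and `φ` is not injective.

For `k = 2`, products of Dirac matrices give an explicit isomorphism with explicit inverse; it
matches the compact forms because real skew matrices correspond to skew-Hermitian ones. -/

/-! ### Lifts of quarter turns -/

/-- A family of group elements `s i j` satisfying the relations between the quarter turns in the
coordinate planes: `s i j` carries the `j`-th axis to the `i`-th axis. -/
structure IsQuarterTurnFamily {ι G : Type*} [Group G] (s : ι → ι → G) : Prop where
  self : ∀ i, s i i = 1
  inv : ∀ i j, s j i = (s i j)⁻¹
  rot : ∀ i j k, i ≠ j → j ≠ k → i ≠ k → s i j * s j k = s i k * s i j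
  comm : ∀ i j k l, i ≠ k → i ≠ l → j ≠ k → j ≠ l → Commute (s i j) (s k l)

namespace IsQuarterTurnFamily

variable {ι G : Type*} [Group G] {s : ι → ι → G} {i j k l : ι}

theorem rot' (h : IsQuarterTurnFamily s) (hij : i ≠ j) (hjk : j ≠ k) (hik : i ≠ k) :
    s i j * s i k = s k j * s i j := by
  have h1 := h.rot k j i hjk.symm hij.symm hik.symm
  have h2 := h.rot i k j hik hjk.symm hij
  have h3 := h.inv i j
  have h4 := h.inv i k
  rw [← h2, ← mul_inv_eq_iff_eq_mul, mul_assoc, ← h3, h1, h4]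
  group

theorem conj_eq (h : IsQuarterTurnFamily s) (hij : i ≠ j) (hjk : j ≠ k) (hik : i ≠ k) :
    s i j * s j k * (s i j)⁻¹ = s i k := by
  rw [h.rot i j k hij hjk hik, mul_inv_cancel_right]

theorem conj_eq' (h : IsQuarterTurnFamily s) (hij : i ≠ j) (hjk : j ≠ k) (hik : i ≠ k) :
    s i j * s i k * (s i j)⁻¹ = s k j := by
  rw [h.rot' hij hjk hik, mul_inv_cancel_right]

/-- Two group elements that invert each other generate a quotient of the quaternion group. -/
theorem sq_eq_sq_and_sq_sq_eq_one_of_conj {a b : G} (hab : a * b * a⁻¹ = b⁻¹)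
    (hba : b * a * b⁻¹ = a⁻¹) : a ^ 2 = b ^ 2 ∧ (a ^ 2) ^ 2 = 1 := by
  have h1 : a ^ 2 = (b ^ 2)⁻¹ := by
    calc a ^ 2 = a * (b * a * b⁻¹)⁻¹ := by rw [hba, inv_inv, sq]
      _ = (a * b * a⁻¹) * b⁻¹ := by group
      _ = (b ^ 2)⁻¹ := by rw [hab, sq, _root_.mul_inv_rev]
  have h2 : a ^ 2 = (a ^ 2)⁻¹ := by
    calc a ^ 2 = b * a ^ 2 * b⁻¹ := by rw [h1]; group
      _ = (a ^ 2)⁻¹ := by rw [← conj_pow, hba, inv_pow]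
  refine ⟨?_, ?_⟩
  · rw [h2, h1, inv_inv]
  · nth_rewrite 1 [sq, h2]
    exact inv_mul_cancel _

/-- Two successive quarter turns in the plane `i j` carry the axis `j` to its opposite: `s j k ↦ s i
k ↦ s k j`. -/
theorem sq_conj (h : IsQuarterTurnFamily s) (hij : i ≠ j) (hjk : j ≠ k) (hik : i ≠ k) :
    s i j ^ 2 * s j k * (s i j ^ 2)⁻¹ = (s j k)⁻¹ := by
  have : s i j ^ 2 * s j k * (s i j ^ 2)⁻¹ =
      s i j * (s i j * s j k * (s i j)⁻¹) * (s i j)⁻¹ := by rw [sq]; group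
  rw [this, h.conj_eq hij hjk hik, h.conj_eq' hij hjk hik, h.inv j k]

theorem sq_symm (h : IsQuarterTurnFamily s) (i j : ι) : s j i ^ 2 = (s i j ^ 2)⁻¹ := by
  rw [h.inv i j, inv_pow]

/-- A half turn in the plane `j k` inverts a quarter turn in a plane `i j`. -/
theorem sq_conj' (h : IsQuarterTurnFamily s) (hij : i ≠ j) (hjk : j ≠ k) (hik : i ≠ k) :
    s j k ^ 2 * s i j * (s j k ^ 2)⁻¹ = (s i j)⁻¹ := by
  have := h.sq_conj hjk.symm hij.symm hik.symm
  rw [h.sq_symm j k, h.inv i j, inv_inv, inv_inv] at this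
  generalize s j k ^ 2 = b at *
  generalize s i j = a at *
  calc b * a * b⁻¹ = b * (b⁻¹ * a⁻¹ * b) * b⁻¹ := by rw [this]
    _ = a⁻¹ := by group

theorem sq_conj_sq (h : IsQuarterTurnFamily s) (hij : i ≠ j) (hjk : j ≠ k) (hik : i ≠ k) :
    s i j ^ 2 * s j k ^ 2 * (s i j ^ 2)⁻¹ = (s j k ^ 2)⁻¹ := by
  rw [← conj_pow, h.sq_conj hij hjk hik, inv_pow]

theorem sq_conj_sq' (h : IsQuarterTurnFamily s) (hij : i ≠ j) (hjk : j ≠ k) (hik : i ≠ k) :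
    s j k ^ 2 * s i j ^ 2 * (s j k ^ 2)⁻¹ = (s i j ^ 2)⁻¹ := by
  rw [← conj_pow, h.sq_conj' hij hjk hik, inv_pow]

/-- With `a = s i j` and `b = s j k ^ 2`, inversion of `a` by `b` gives `a * b * a = b`, and `a * b
* a⁻¹` is the half turn in the plane `i k`. -/
theorem sq_mul_sq (h : IsQuarterTurnFamily s) (hij : i ≠ j) (hjk : j ≠ k) (hik : i ≠ k) :
    s i k ^ 2 * s i j ^ 2 = s j k ^ 2 := by
  have h1 : s i j * s j k ^ 2 * (s i j)⁻¹ = s i k ^ 2 := by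
    rw [← conj_pow, h.conj_eq hij hjk hik]
  have h2 := h.sq_conj' hij hjk hik
  rw [← h1]
  generalize s j k ^ 2 = b at *
  generalize s i j = a at *
  have h3 : a * b * a = b := by
    have : b * a = a⁻¹ * b := by rw [← h2]; group
    rw [mul_assoc, this, mul_inv_cancel_left]
  calc a * b * a⁻¹ * a ^ 2 = a * b * a := by rw [sq]; group
    _ = b := h3

/-- Half turns in planes sharing an axis invert each other, so the quaternion relations apply to
them. -/
theorem full_turn_sq (h : IsQuarterTurnFamily s) (hij : i ≠ j) (hjk : j ≠ k) (hik : i ≠ k) :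
    ((s i j ^ 2) ^ 2) ^ 2 = 1 :=
  (sq_eq_sq_and_sq_sq_eq_one_of_conj (h.sq_conj_sq hij hjk hik) (h.sq_conj_sq' hij hjk hik)).2

theorem full_turn_eq (h : IsQuarterTurnFamily s) (hij : i ≠ j) (hjk : j ≠ k) (hik : i ≠ k) :
    (s i j ^ 2) ^ 2 = (s j k ^ 2) ^ 2 :=
  (sq_eq_sq_and_sq_sq_eq_one_of_conj (h.sq_conj_sq hij hjk hik) (h.sq_conj_sq' hij hjk hik)).1

/-- All the full turns are the same group element `z`, which has order at most two. -/
theorem exists_full_turn (h : IsQuarterTurnFamily s) (hι : ∀ i j : ι, ∃ k, i ≠ k ∧ j ≠ k)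
    [Nonempty ι] :
    ∃ z : G, z ^ 2 = 1 ∧ ∀ i j, i ≠ j → (s i j ^ 2) ^ 2 = z := by
  obtain ⟨o⟩ := ‹Nonempty ι›
  obtain ⟨p, hop, -⟩ := hι o o
  have hone : ∀ i j, i ≠ j → ((s i j ^ 2) ^ 2) ^ 2 = 1 := fun i j hij ↦ by
    obtain ⟨k, hik, hjk⟩ := hι i j
    exact h.full_turn_sq hij hjk hik
  have hsymm : ∀ i j, i ≠ j → (s i j ^ 2) ^ 2 = (s j i ^ 2) ^ 2 := fun i j hij ↦ by
    rw [h.sq_symm i j, inv_pow, eq_inv_iff_mul_eq_one, ← sq, hone i j hij]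
  -- Full turns agree on planes with a common axis; any two planes are linked by a chain of such
  -- planes.
  have hshare : ∀ i j k, i ≠ j → i ≠ k → (s i j ^ 2) ^ 2 = (s i k ^ 2) ^ 2 := fun i j k hij hik ↦ by
    by_cases hjk : j = k
    · rw [hjk]
    · rw [hsymm i j hij, h.full_turn_eq hij.symm hik hjk]
  refine ⟨(s o p ^ 2) ^ 2, hone o p hop, fun i j hij ↦ ?_⟩
  by_cases hio : i = o
  · subst hio
    exact hshare _ _ _ hij hop
  · rw [hshare i j o hij hio, hsymm i o hio, hshare o i p (Ne.symm hio) hop]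

theorem commute_full_turn (h : IsQuarterTurnFamily s)
    {z : G} (hz : ∀ i j, i ≠ j → (s i j ^ 2) ^ 2 = z) (i j : ι) : Commute z (s i j) := by
  by_cases hij : i = j
  · rw [hij, h.self]; exact Commute.one_right _
  · rw [← hz i j hij]
    exact ((Commute.refl _).pow_left _).pow_left _

theorem sq_comm_sq (h : IsQuarterTurnFamily s) (hik : i ≠ k) (hil : i ≠ l) (hjk : j ≠ k)
    (hjl : j ≠ l) : Commute (s i j ^ 2) (s k l ^ 2) :=
  ((h.comm i j k l hik hil hjk hjl).pow_left _).pow_right _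

/-- Half turns in planes sharing an axis commute up to the full turn. -/
theorem sq_mul_sq_eq (h : IsQuarterTurnFamily s) {z : G} (hz2 : z ^ 2 = 1)
    (hz : ∀ i j, i ≠ j → (s i j ^ 2) ^ 2 = z) (hij : i ≠ j) (hjk : j ≠ k) (hik : i ≠ k) :
    s i j ^ 2 * s j k ^ 2 = z * (s j k ^ 2 * s i j ^ 2) := by
  have h1 := h.sq_conj_sq hij hjk hik
  have h2 := hz j k hjk
  have h3 : (s j k ^ 2)⁻¹ = z * s j k ^ 2 := by
    rw [inv_eq_iff_mul_eq_one, ← h2] 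
    rw [← h2] at hz2
    calc _ = ((s j k ^ 2) ^ 2) ^ 2 := by group
      _ = 1 := hz2
  rw [mul_inv_eq_iff_eq_mul, h3] at h1
  rw [h1, mul_assoc]

end IsQuarterTurnFamily

/-! ### Alternating forms and commuting involutions -/

section Involutions

variable {K V : Type*} [Field K] [AddCommGroup V] [Module K V]

/-- A space containing `τ` mutually orthogonal hyperbolic pairs has dimension at least `2 |τ|`. -/
theorem two_mul_card_le_finrank_of_hyperbolic_pairs [FiniteDimensional K V] {τ : Type*} [Fintype τ]
    (ω : V →ₗ[K] V →ₗ[K] K) (v w : τ → V) (hvv : ∀ t t', ω (v t) (v t') = 0)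
    (hww : ∀ t t', ω (w t) (w t') = 0) (hvw : ∀ t t', t ≠ t' → ω (v t) (w t') = 0)
    (hwv : ∀ t t', t ≠ t' → ω (w t) (v t') = 0)
    (hne : ∀ t, ω (v t) (w t) ≠ 0) (hne' : ∀ t, ω (w t) (v t) ≠ 0) :
    2 * Fintype.card τ ≤ Module.finrank K V := by
  classical
  have hli : LinearIndependent K (Sum.elim v w) := by
    rw [Fintype.linearIndependent_iff]
    intro g hg
    rw [Fintype.sum_sum_type] at hg
    simp only [Sum.elim_inl, Sum.elim_inr] at hg
    rintro (t | t)
    · have := congrArg (fun u ↦ ω u (w t)) hg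
      simp only [map_add, map_sum, map_smul, LinearMap.add_apply, LinearMap.sum_apply,
        LinearMap.smul_apply, hww, smul_zero, Finset.sum_const_zero, add_zero, map_zero,
        LinearMap.zero_apply] at this
      rw [Finset.sum_eq_single t (fun b _ hb ↦ by rw [hvw b t hb, smul_zero]) (by simp)] at this
      simpa [hne t] using this
    · have := congrArg (fun u ↦ ω u (v t)) hg
      simp only [map_add, map_sum, map_smul, LinearMap.add_apply, LinearMap.sum_apply,
        LinearMap.smul_apply, hvv, smul_zero, Finset.sum_const_zero, zero_add, map_zero,
        LinearMap.zero_apply] at this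
      rw [Finset.sum_eq_single t (fun b _ hb ↦ by rw [hwv b t hb, smul_zero]) (by simp)] at this
      simpa [hne' t] using this
  have := hli.fintype_card_le_finrank
  rw [Fintype.card_sum] at this
  omega

/-- The joint eigenspace of a family of linear automorphisms. -/
def jointEigenspace {ι : Type*} (a : ι → V ≃ₗ[K] V) (χ : ι → K) : Submodule K V :=
  ⨅ i, LinearMap.ker ((a i : V →ₗ[K] V) - χ i • LinearMap.id)

theorem mem_jointEigenspace {ι : Type*} {a : ι → V ≃ₗ[K] V} {χ : ι → K} {v : V} :
    v ∈ jointEigenspace a χ ↔ ∀ i, a i v = χ i • v := by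
  simp [jointEigenspace, sub_eq_zero]

/-- The joint eigenspaces of commuting isometric involutions are nondegenerate. -/
theorem exists_mem_jointEigenspace_form_ne_zero {ι : Type*} [Finite ι] [NeZero (2 : K)]
    (ω : V →ₗ[K] V →ₗ[K] K) (hω : ∀ v, v ≠ 0 → ∃ w, ω v w ≠ 0) (a : ι → V ≃ₗ[K] V)
    (ha : ∀ i v w, ω (a i v) (a i w) = ω v w) (hcomm : ∀ i j, Commute (a i) (a j))
    (hsq : ∀ i, a i ^ 2 = 1) (χ : ι → K) (hχ : ∀ i, χ i * χ i = 1)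
    {v : V} (hv : v ∈ jointEigenspace a χ) (hv0 : v ≠ 0) :
    ∃ w ∈ jointEigenspace a χ, ω v w ≠ 0 := by
  classical
  cases nonempty_fintype ι
  rw [mem_jointEigenspace] at hv
  suffices ∀ F : Finset ι, ∃ w, (∀ i ∈ F, a i w = χ i • w) ∧ ω v w ≠ 0 by
    obtain ⟨w, hw, h⟩ := this Finset.univ
    exact ⟨w, mem_jointEigenspace.2 fun i ↦ hw i (Finset.mem_univ i), h⟩
  intro F
  induction F using Finset.induction_on with
  | empty =>
    obtain ⟨w, hw⟩ := hω v hv0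
    exact ⟨w, by simp, hw⟩
  | insert i F hi ih =>
    obtain ⟨w, hw, hvw⟩ := ih
    have hii : ∀ u, a i (a i u) = u := fun u ↦ by
      rw [← LinearEquiv.mul_apply, ← sq, hsq, LinearEquiv.coe_one, id]
    -- Twice the projection of `w` to the `χ i`-eigenspace of `a i`. As `v` is an eigenvector with
    -- the same sign and `a i` is an isometry, the pairing with `v` merely doubles.
    refine ⟨w + χ i • a i w, ?_, ?_⟩
    · intro j hj
      rcases Finset.mem_insert.1 hj with rfl | hj
      · rw [map_add, map_smul, hii, smul_add, smul_smul, hχ, one_smul, add_comm]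
      · rw [map_add, map_smul, ← LinearEquiv.mul_apply, (hcomm j i).eq, LinearEquiv.mul_apply,
          hw j hj, map_smul, smul_add, smul_comm]
    · have h1 : χ i * ω v (a i w) = ω v w := by
        have := ha i v w
        rw [hv i] at this
        simpa using this
      rw [map_add, map_smul, smul_eq_mul, h1, ← two_mul]
      exact mul_ne_zero two_ne_zero hvw

/-- Commuting involutions have a joint eigenvector in any invariant nonzero eigenspace of one of
them. -/
theorem exists_jointEigenvector {ι : Type*} [Finite ι] [NeZero (2 : K)]
    (a : ι → V ≃ₗ[K] V) (hcomm : ∀ i j, Commute (a i) (a j)) (hsq : ∀ i, a i ^ 2 = 1)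
    {v : V} (hv : v ≠ 0) (i₀ : ι) (c : K) (hvc : a i₀ v = c • v) :
    ∃ w ≠ 0, a i₀ w = c • w ∧ ∀ i, a i w = w ∨ a i w = -w := by
  classical
  cases nonempty_fintype ι
  suffices ∀ F : Finset ι, ∃ w ≠ 0, a i₀ w = c • w ∧ ∀ i ∈ F, a i w = w ∨ a i w = -w by
    obtain ⟨w, hw, h0, h⟩ := this Finset.univ
    exact ⟨w, hw, h0, fun i ↦ h i (Finset.mem_univ i)⟩
  intro F
  induction F using Finset.induction_on with
  | empty => exact ⟨v, hv, hvc, by simp⟩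
  | insert i F hi ih =>
    obtain ⟨w, hw, hw0, hwF⟩ := ih
    have hii : ∀ u, a i (a i u) = u := fun u ↦ by
      rw [← LinearEquiv.mul_apply, ← sq, hsq, LinearEquiv.coe_one, id]
    have hsw : ∀ j u, a j (a i u) = a i (a j u) := fun j u ↦ by
      rw [← LinearEquiv.mul_apply, (hcomm j i).eq, LinearEquiv.mul_apply]
    by_cases hz : a i w = -w
    · refine ⟨w, hw, hw0, fun j hj ↦ ?_⟩
      rcases Finset.mem_insert.1 hj with rfl | hj
      · exact Or.inr hz
      · exact hwF j hj
    -- Unless `w` is already negated by `a i`, its symmetrization is nonzero and fixed by `a i`;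
    -- commutation keeps the earlier signs.
    · refine ⟨w + a i w, fun h ↦ hz (eq_neg_of_add_eq_zero_right h), ?_, fun j hj ↦ ?_⟩
      · rw [map_add, hsw, hw0, map_smul, smul_add]
      · rcases Finset.mem_insert.1 hj with rfl | hj
        · exact Or.inl (by rw [map_add, hii, add_comm])
        · rcases hwF j hj with h | h
          · exact Or.inl (by rw [map_add, hsw, h])
          · exact Or.inr (by rw [map_add, hsw, h, map_neg, neg_add])

/-- If an automorphism `y` of `W` anticommutes with an operator `x` on `W` of square `c ^ 2`, then
`y` exchanges the two eigenspaces of `x`. -/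
theorem finrank_eq_two_mul_of_anticommute [FiniteDimensional K V] [NeZero (2 : K)]
    (W : Submodule K V) (x y : V ≃ₗ[K] V) {c : K} (hc : c ≠ 0) (hxW : ∀ v ∈ W, x v ∈ W)
    (hyW : ∀ v ∈ W, y v ∈ W) (hx : ∀ v ∈ W, x (x v) = (c * c) • v)
    (hxy : ∀ v ∈ W, x (y v) = -y (x v)) :
    Module.finrank K W =
      2 * Module.finrank K ↥(W ⊓ LinearMap.ker ((x : V →ₗ[K] V) - c • LinearMap.id)) := by
  set P := W ⊓ LinearMap.ker ((x : V →ₗ[K] V) - c • LinearMap.id) with hP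
  set M := W ⊓ LinearMap.ker ((x : V →ₗ[K] V) + c • LinearMap.id) with hM
  have memP : ∀ v, v ∈ P ↔ v ∈ W ∧ x v = c • v := fun v ↦ by simp [hP, sub_eq_zero]
  have memM : ∀ v, v ∈ M ↔ v ∈ W ∧ x v = -(c • v) := fun v ↦ by
    simp [hM, add_eq_zero_iff_eq_neg]
  have hdisj : Disjoint P M := by
    rw [Submodule.disjoint_def]
    intro v hv hv'
    rw [memP] at hv
    rw [memM, hv.2] at hv'
    have : (2 * c) • v = 0 := by
      rw [mul_smul, two_smul]; nth_rewrite 1 [hv'.2]; exact neg_add_cancel _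
    exact (smul_eq_zero.1 this).resolve_left (mul_ne_zero two_ne_zero hc)
  have hsup : P ⊔ M = W := by
    apply le_antisymm (sup_le inf_le_left inf_le_left)
    intro v hv
    have h2c : (2 * c) ≠ 0 := mul_ne_zero two_ne_zero hc
    -- Since `x` has square `c ^ 2` on `W`, the vectors `c • v ± x v` are eigenvectors for `± c`.
    have e : v = (2 * c)⁻¹ • (c • v + x v) + (2 * c)⁻¹ • (c • v - x v) := by
      rw [← smul_add, add_add_sub_cancel, ← two_smul K, smul_smul, smul_smul,
        mul_assoc, inv_mul_cancel₀ h2c, one_smul]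
    rw [e]
    refine Submodule.add_mem_sup (P.smul_mem _ ?_) (M.smul_mem _ ?_)
    · rw [memP]
      refine ⟨W.add_mem (W.smul_mem _ hv) (hxW v hv), ?_⟩
      rw [map_add, hx v hv, map_smul, smul_add, smul_smul, add_comm]
    · rw [memM]
      refine ⟨W.sub_mem (W.smul_mem _ hv) (hxW v hv), ?_⟩
      rw [map_sub, hx v hv, map_smul, smul_sub, smul_smul, neg_sub]
  have hPM : Module.finrank K P ≤ Module.finrank K M := by
    refine LinearMap.finrank_le_finrank_of_injective
      (f := ((y : V →ₗ[K] V).restrict (p := P) (q := M) ?_)) ?_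
    · intro v hv
      rw [memP] at hv
      rw [memM]
      refine ⟨hyW v hv.1, ?_⟩
      rw [LinearEquiv.coe_coe, hxy v hv.1, hv.2, map_smul]
    · intro u v huv
      exact Subtype.ext (y.injective (congrArg Subtype.val huv))
  have hMP : Module.finrank K M ≤ Module.finrank K P := by
    refine LinearMap.finrank_le_finrank_of_injective
      (f := ((y : V →ₗ[K] V).restrict (p := M) (q := P) ?_)) ?_
    · intro v hv
      rw [memM] at hv
      rw [memP]
      refine ⟨hyW v hv.1, ?_⟩
      rw [LinearEquiv.coe_coe, hxy v hv.1, hv.2, map_neg, map_smul, neg_neg]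
    · intro u v huv
      exact Subtype.ext (y.injective (congrArg Subtype.val huv))
  have := Submodule.finrank_sup_add_finrank_inf_eq P M
  rw [hsup, hdisj.eq_bot, finrank_bot] at this
  omega

/-- If `m` commuting operators on `W` of square `c ^ 2` can have their signs changed independently
by conjugation, their joint eigenspaces have dimension `2 ^ (-m) * dim W`. -/
theorem finrank_eq_two_pow_mul [FiniteDimensional K V] [NeZero (2 : K)]
    (W : Submodule K V) (m : ℕ) (x y : ℕ → V ≃ₗ[K] V) {c : K} (hc : c ≠ 0)
    (hxW : ∀ i < m, ∀ v ∈ W, x i v ∈ W) (hyW : ∀ i < m, ∀ v ∈ W, y i v ∈ W)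
    (hx : ∀ i < m, ∀ v ∈ W, x i (x i v) = (c * c) • v)
    (hxy : ∀ i < m, ∀ v ∈ W, x i (y i v) = -y i (x i v))
    (hxx : ∀ i < m, ∀ j < m, Commute (x i) (x j))
    (hxy' : ∀ i < m, ∀ j < m, i ≠ j → Commute (x i) (y j)) :
    ∃ U : Submodule K V, (∀ v, v ∈ U ↔ v ∈ W ∧ ∀ i < m, x i v = c • v) ∧
      Module.finrank K W = 2 ^ m * Module.finrank K U := by
  suffices ∀ n ≤ m, ∃ U : Submodule K V, (∀ v, v ∈ U ↔ v ∈ W ∧ ∀ i < n, x i v = c • v) ∧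
      Module.finrank K W = 2 ^ n * Module.finrank K U from this m le_rfl
  intro n
  induction n with
  | zero => exact fun _ ↦ ⟨W, by simp, by simp⟩
  | succ n ih =>
    intro hn
    obtain ⟨U, hU, hd⟩ := ih (by omega)
    refine ⟨U ⊓ LinearMap.ker ((x n : V →ₗ[K] V) - c • LinearMap.id), ?_, ?_⟩
    rotate_left
    · rw [finrank_eq_two_mul_of_anticommute U (x n) (y n) hc ?_ ?_ ?_ ?_, ← mul_assoc,
        ← pow_succ] at hd
      · exact hd
      · intro v hv
        rw [hU] at hv ⊢
        refine ⟨hxW n hn v hv.1, fun i hi ↦ ?_⟩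
        rw [← LinearEquiv.mul_apply, (hxx i (by omega) n hn).eq, LinearEquiv.mul_apply, hv.2 i hi,
          map_smul]
      · intro v hv
        rw [hU] at hv ⊢
        refine ⟨hyW n hn v hv.1, fun i hi ↦ ?_⟩
        rw [← LinearEquiv.mul_apply, (hxy' i (by omega) n hn (by omega)).eq,
          LinearEquiv.mul_apply, hv.2 i hi, map_smul]
      · exact fun v hv ↦ hx n hn v ((hU v).1 hv).1
      · exact fun v hv ↦ hxy n hn v ((hU v).1 hv).1
    · intro v
      rw [Submodule.mem_inf, hU, and_assoc]
      refine and_congr_right fun _ ↦ ?_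
      simp only [LinearMap.mem_ker, LinearMap.sub_apply, LinearEquiv.coe_coe,
        LinearMap.smul_apply, LinearMap.id_apply, sub_eq_zero]
      constructor
      · rintro ⟨h1, h2⟩ i hi
        rcases Nat.lt_succ_iff_lt_or_eq.1 hi with h | rfl
        exacts [h1 i h, h2]
      · exact fun h ↦ ⟨fun i hi ↦ h i (by omega), h n (by omega)⟩

end Involutions

/-! ### Symplectic representations of the quarter turns -/

namespace IsQuarterTurnFamily

variable {V : Type*} [AddCommGroup V] [Module ℂ V] {ι : Type*} {s : ι → ι → V ≃ₗ[ℂ] V}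

theorem commute_sq_full_turn (h : IsQuarterTurnFamily s) {z : V ≃ₗ[ℂ] V}
    (hz : ∀ i j, i ≠ j → (s i j ^ 2) ^ 2 = z) (i j : ι) : Commute z (s i j ^ 2) :=
  (h.commute_full_turn hz i j).pow_right 2

theorem half_turn_mapsTo (h : IsQuarterTurnFamily s) {z : V ≃ₗ[ℂ] V}
    (hz : ∀ i j, i ≠ j → (s i j ^ 2) ^ 2 = z) (i j : ι) {v : V} (hv : z v = -v) :
    z ((s i j ^ 2) v) = -(s i j ^ 2) v := by
  rw [← LinearEquiv.mul_apply, (h.commute_sq_full_turn hz i j).eq, LinearEquiv.mul_apply, hv,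
    map_neg]

theorem half_turn_anticommute (h : IsQuarterTurnFamily s) {z : V ≃ₗ[ℂ] V} (hz2 : z ^ 2 = 1)
    (hz : ∀ i j, i ≠ j → (s i j ^ 2) ^ 2 = z) {i j k : ι} (hij : i ≠ j) (hjk : j ≠ k) (hik : i ≠ k)
    {v : V} (hv : z v = -v) :
    (s i j ^ 2) ((s j k ^ 2) v) = -(s j k ^ 2) ((s i j ^ 2) v) := by
  rw [← LinearEquiv.mul_apply, h.sq_mul_sq_eq hz2 hz hij hjk hik, LinearEquiv.mul_apply,
    LinearEquiv.mul_apply, h.half_turn_mapsTo hz j k (h.half_turn_mapsTo hz i j hv)]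

/-- `TwistedCommute z m x y` says that `x` and `y` commute up to the factor `z ^ m`. -/
def TwistedCommute {G : Type*} [Group G] (z : G) (m : ℕ) (x y : G) : Prop :=
  x * y = z ^ m * (y * x)

/-- For products of half turns the exponent counts the pairs of factors whose planes share exactly
one axis; only its parity matters once `z ^ 2 = 1`. -/
theorem TwistedCommute.mul_left {G : Type*} [Group G] {z x₁ x₂ y : G} {m n : ℕ}
    (h₁ : TwistedCommute z m x₁ y) (h₂ : TwistedCommute z n x₂ y) (hz : Commute z x₁) :
    TwistedCommute z (n + m) (x₁ * x₂) y := by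
  unfold TwistedCommute at *
  rw [mul_assoc, h₂, ← mul_assoc, ← ((hz.pow_left n).eq), mul_assoc, ← mul_assoc x₁, h₁]
  simp only [pow_add, mul_assoc]

theorem TwistedCommute.symm {G : Type*} [Group G] {z x y : G} {m : ℕ}
    (h : TwistedCommute z m x y) (hz : z ^ 2 = 1) : TwistedCommute z m y x := by
  unfold TwistedCommute at *
  rw [h, ← mul_assoc, ← pow_add, ← two_mul, pow_mul, hz, one_pow, one_mul]

theorem TwistedCommute.commute {G : Type*} [Group G] {z x y : G} {m : ℕ}
    (h : TwistedCommute z (2 * m) x y) (hz : z ^ 2 = 1) : Commute x y := by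
  unfold TwistedCommute at h
  rwa [pow_mul, hz, one_pow, one_mul] at h

/-- The space on which the full turn acts as `-1` is a sum of spin representations. -/
theorem two_pow_le_finrank_of_full_turn [FiniteDimensional ℂ V] (h : IsQuarterTurnFamily s)
    {z : V ≃ₗ[ℂ] V} (hz2 : z ^ 2 = 1) (hz : ∀ i j, i ≠ j → (s i j ^ 2) ^ 2 = z)
    (k : ℕ) (e : ℕ → ι) (he : ∀ m n, m < 2 * k + 1 → n < 2 * k + 1 → m ≠ n → e m ≠ e n)
    {v : V} (hv : z v = -v) (hv0 : v ≠ 0) : 2 ^ k ≤ Module.finrank ℂ V := by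
  set W : Submodule ℂ V := LinearMap.ker ((z : V →ₗ[ℂ] V) + LinearMap.id) with hW
  have memW : ∀ v, v ∈ W ↔ z v = -v := fun v ↦ by simp [hW, add_eq_zero_iff_eq_neg]
  -- The `k` disjoint planes `(2i, 2i+1)` give commuting operators of square `-1`, with eigenvalue
  -- `I`. The half turn in the plane of `2i+1` and the spare axis `2k` meets only the `i`-th of
  -- them, so it flips that sign alone.
  obtain ⟨U, -, hU⟩ := finrank_eq_two_pow_mul W k (fun i ↦ s (e (2 * i)) (e (2 * i + 1)) ^ 2)
    (fun i ↦ s (e (2 * i + 1)) (e (2 * k)) ^ 2) Complex.I_ne_zero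
    (fun i _ v hv ↦ (memW _).2 (h.half_turn_mapsTo hz _ _ ((memW v).1 hv)))
    (fun i _ v hv ↦ (memW _).2 (h.half_turn_mapsTo hz _ _ ((memW v).1 hv)))
    (fun i hi v hv ↦ by
      rw [← LinearEquiv.mul_apply, ← sq, hz _ _ (he _ _ (by omega) (by omega) (by omega)),
        (memW v).1 hv, Complex.I_mul_I, neg_one_smul])
    (fun i hi v hv ↦ h.half_turn_anticommute hz2 hz (he _ _ (by omega) (by omega) (by omega))
      (he _ _ (by omega) (by omega) (by omega)) (he _ _ (by omega) (by omega) (by omega))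
      ((memW v).1 hv))
    (fun i hi j hj ↦ by
      by_cases hij : i = j
      · rw [hij]
      · exact h.sq_comm_sq (he _ _ (by omega) (by omega) (by omega))
          (he _ _ (by omega) (by omega) (by omega)) (he _ _ (by omega) (by omega) (by omega))
          (he _ _ (by omega) (by omega) (by omega)))
    (fun i hi j hj hij ↦ h.sq_comm_sq (he _ _ (by omega) (by omega) (by omega))
          (he _ _ (by omega) (by omega) (by omega)) (he _ _ (by omega) (by omega) (by omega))
          (he _ _ (by omega) (by omega) (by omega)))
  have hWpos : 0 < Module.finrank ℂ W := by
    rw [Module.finrank_pos_iff, Submodule.nontrivial_iff_ne_bot]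
    exact fun hb ↦ hv0 (by simpa [hb] using (memW v).2 hv)
  have hle := W.finrank_le
  have : 0 < Module.finrank ℂ U := Nat.pos_of_ne_zero fun h0 ↦ by rw [h0, mul_zero] at hU; omega
  nlinarith [Nat.one_le_two_pow (n := k)]

/-- Half turns in planes `i j` and `i k` commute up to the full turn. -/
theorem sq_mul_sq_eq' {G : Type*} [Group G] {s : ι → ι → G} (h : IsQuarterTurnFamily s) {z : G}
    (hz2 : z ^ 2 = 1) (hz : ∀ i j, i ≠ j → (s i j ^ 2) ^ 2 = z) {i j k : ι} (hij : i ≠ j)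
    (hjk : j ≠ k) (hik : i ≠ k) :
    s i j ^ 2 * s i k ^ 2 = z * (s i k ^ 2 * s i j ^ 2) := by
  have h1 := h.sq_mul_sq_eq hz2 hz hij.symm hik hjk
  rw [h.sq_symm i j, inv_mul_eq_iff_eq_mul] at h1
  have hzc := (h.commute_full_turn hz i j).pow_right 2
  have hzc' := (h.commute_full_turn hz i k).pow_right 2
  generalize s i j ^ 2 = a at *
  generalize s i k ^ 2 = b at *
  have h2 : a * b = z⁻¹ * (b * a) := by
    rw [eq_inv_mul_iff_mul_eq]
    nth_rewrite 2 [h1]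
    rw [← mul_assoc, hzc.eq]
    group
  rw [h2, inv_eq_iff_mul_eq_one.2 (by rw [← sq, hz2] : z * z = 1)]

/-- The eight-dimensional spin representation in dimension seven is not symplectic. -/
theorem sixteen_le_finrank_of_full_turn [FiniteDimensional ℂ V] (h : IsQuarterTurnFamily s)
    {z : V ≃ₗ[ℂ] V} (hz2 : z ^ 2 = 1) (hz : ∀ i j, i ≠ j → (s i j ^ 2) ^ 2 = z)
    (e : ℕ → ι) (he : ∀ m n, m < 7 → n < 7 → m ≠ n → e m ≠ e n)
    (ω : V →ₗ[ℂ] V →ₗ[ℂ] ℂ) (hω : ∀ v, v ≠ 0 → ∃ w, ω v w ≠ 0) (halt : ω.IsAlt)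
    (hs : ∀ i j v w, ω (s i j v) (s i j w) = ω v w)
    {v : V} (hv : z v = -v) (hv0 : v ≠ 0) : 16 ≤ Module.finrank ℂ V := by
  set W : Submodule ℂ V := LinearMap.ker ((z : V →ₗ[ℂ] V) + LinearMap.id) with hW
  have memW : ∀ v, v ∈ W ↔ z v = -v := fun v ↦ by simp [hW, add_eq_zero_iff_eq_neg]
  obtain ⟨a, ha⟩ : ∃ a : ℕ → ℕ → V ≃ₗ[ℂ] V, ∀ i j, a i j = s (e i) (e j) ^ 2 := ⟨_, fun _ _ ↦ rfl⟩
  have aW : ∀ i j, ∀ v ∈ W, a i j v ∈ W := fun i j v hv ↦ by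
    rw [ha]; exact (memW _).2 (h.half_turn_mapsTo hz _ _ ((memW v).1 hv))
  have az : ∀ i j, Commute z (a i j) := fun i j ↦ by rw [ha]; exact h.commute_sq_full_turn hz _ _
  have asq : ∀ i j, i < 7 ∧ j < 7 ∧ i ≠ j → a i j ^ 2 = z := fun i j ⟨hi, hj, hij⟩ ↦ by
    rw [ha, hz _ _ (he _ _ hi hj hij)]
  have aω : ∀ i j v w, ω (a i j v) (a i j w) = ω v w := fun i j v w ↦ by
    rw [ha, sq, LinearEquiv.mul_apply, LinearEquiv.mul_apply, hs, hs]
  have comm : ∀ i j k l,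
      i < 7 ∧ j < 7 ∧ k < 7 ∧ l < 7 ∧ i ≠ k ∧ i ≠ l ∧ j ≠ k ∧ j ≠ l →
      Commute (a i j) (a k l) := fun i j k l ⟨hi, hj, hk, hl, h1, h2, h3, h4⟩ ↦ by
    rw [ha, ha]
    exact h.sq_comm_sq (he _ _ hi hk h1) (he _ _ hi hl h2) (he _ _ hj hk h3) (he _ _ hj hl h4)
  have tw0 : ∀ i j k l,
      i < 7 ∧ j < 7 ∧ k < 7 ∧ l < 7 ∧ i ≠ k ∧ i ≠ l ∧ j ≠ k ∧ j ≠ l →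
      TwistedCommute z 0 (a i j) (a k l) := fun i j k l H ↦ by
    rw [TwistedCommute, pow_zero, one_mul, (comm i j k l H).eq]
  have tws : ∀ i j, TwistedCommute z 0 (a i j) (a i j) := fun i j ↦ by
    rw [TwistedCommute, pow_zero, one_mul]
  have tw1 : ∀ i j k, i < 7 ∧ j < 7 ∧ k < 7 ∧ i ≠ j ∧ j ≠ k ∧ i ≠ k →
      TwistedCommute z 1 (a i j) (a j k) := fun i j k ⟨hi, hj, hk, h1, h2, h3⟩ ↦ by
    rw [TwistedCommute, pow_one, ha, ha, h.sq_mul_sq_eq hz2 hz (he _ _ hi hj h1) (he _ _ hj hk h2)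
      (he _ _ hi hk h3)]
  have tw2 : ∀ i j k, i < 7 ∧ j < 7 ∧ k < 7 ∧ i ≠ j ∧ j ≠ k ∧ i ≠ k →
      TwistedCommute z 1 (a i j) (a i k) := fun i j k ⟨hi, hj, hk, h1, h2, h3⟩ ↦ by
    rw [TwistedCommute, pow_one, ha, ha, h.sq_mul_sq_eq' hz2 hz (he _ _ hi hj h1) (he _ _ hj hk h2)
      (he _ _ hi hk h3)]
  have anti : ∀ x i j, TwistedCommute z 1 x (a i j) → (∀ v ∈ W, x v ∈ W) →
      ∀ v ∈ W, x (a i j v) = -a i j (x v) := fun x i j hx hxW v hv ↦ by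
    rw [← LinearEquiv.mul_apply, show x * a i j = z * (a i j * x) by simpa [TwistedCommute] using hx,
      LinearEquiv.mul_apply, LinearEquiv.mul_apply]
    exact (memW _).1 (aW _ _ _ (hxW v hv))
  -- Half turns in two disjoint planes multiply to an involution, since the two full turns cancel.
  obtain ⟨u, hu⟩ : ∃ u : ℕ → ℕ → ℕ → ℕ → V ≃ₗ[ℂ] V, ∀ i j k l, u i j k l = a i j * a k l :=
    ⟨_, fun _ _ _ _ ↦ rfl⟩
  have uW : ∀ i j k l, ∀ v ∈ W, u i j k l v ∈ W := fun i j k l v hv ↦ by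
    rw [hu]; exact aW _ _ _ (aW _ _ _ hv)
  have uz : ∀ i j k l, Commute z (u i j k l) := fun i j k l ↦ by
    rw [hu]; exact (az _ _).mul_right (az _ _)
  have uω : ∀ i j k l v w, ω (u i j k l v) (u i j k l w) = ω v w := fun i j k l v w ↦ by
    rw [hu, LinearEquiv.mul_apply, LinearEquiv.mul_apply, aω, aω]
  have usq : ∀ i j k l,
      (i ≠ j ∧ k ≠ l) ∧ i < 7 ∧ j < 7 ∧ k < 7 ∧ l < 7 ∧ i ≠ k ∧ i ≠ l ∧ j ≠ k ∧ j ≠ l →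
      u i j k l ^ 2 = 1 := fun i j k l ⟨⟨h0, h0'⟩, H⟩ ↦ by
    rw [hu, (comm i j k l H).mul_pow, asq i j ⟨H.1, H.2.1, h0⟩,
      asq k l ⟨H.2.2.1, H.2.2.2.1, h0'⟩, ← sq, hz2]
  have utw : ∀ {i j k l m n y}, TwistedCommute z m (a i j) y → TwistedCommute z n (a k l) y →
      TwistedCommute z (n + m) (u i j k l) y := fun {i j k l m n y} h1 h2 ↦ by
    rw [hu]; exact h1.mul_left h2 (az _ _)
  -- The supports `0123`, `0145`, `0264` meet pairwise in two indices, which makes the three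
  -- involutions commute.
  have c12 : Commute (u 0 1 2 3) (u 0 1 4 5) := by
    refine TwistedCommute.commute (m := 0) (utw (m := 0) (n := 0) ?_ ?_) hz2
    · exact (utw (tws 0 1) (tw0 4 5 0 1 (by simp))).symm hz2
    · exact (utw (tw0 0 1 2 3 (by simp)) (tw0 4 5 2 3 (by simp))).symm hz2
  have c13 : Commute (u 0 1 2 3) (u 0 2 6 4) := by
    refine TwistedCommute.commute (m := 1) (utw (m := 1) (n := 1) ?_ ?_) hz2
    · exact (utw (m := 1) (n := 0) (tw2 0 2 1 (by simp)) (tw0 6 4 0 1 (by simp))).symm hz2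
    · exact (utw (m := 1) (n := 0) (tw1 0 2 3 (by simp)) (tw0 6 4 2 3 (by simp))).symm hz2
  have c23 : Commute (u 0 1 4 5) (u 0 2 6 4) := by
    refine TwistedCommute.commute (m := 1) (utw (m := 1) (n := 1) ?_ ?_) hz2
    · exact (utw (m := 1) (n := 0) (tw2 0 2 1 (by simp)) (tw0 6 4 0 1 (by simp))).symm hz2
    · exact (utw (m := 0) (n := 1) (tw0 0 2 4 5 (by simp)) (tw1 6 4 5 (by simp))).symm hz2
  have s1 := usq 0 1 2 3 (by simp)
  have s2 := usq 0 1 4 5 (by simp)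
  have s3 := usq 0 2 6 4 (by simp)
  -- A half turn anticommutes on `W` with `u` exactly when its plane meets the support in one index.
  -- The planes `26`, `64`, `23` each do so for just one of the three supports.
  have f11 : TwistedCommute z 1 (u 0 1 2 3) (a 2 6) :=
    utw (tw0 0 1 2 6 (by simp)) (tw2 2 3 6 (by simp))
  have f21 : Commute (u 0 1 4 5) (a 2 6) :=
    TwistedCommute.commute (m := 0) (utw (tw0 0 1 2 6 (by simp)) (tw0 4 5 2 6 (by simp))) hz2
  have f31 : Commute (u 0 2 6 4) (a 2 6) :=
    TwistedCommute.commute (m := 1) (utw (m := 1) (n := 1) (tw1 0 2 6 (by simp))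
      ((tw1 2 6 4 (by simp)).symm hz2)) hz2
  have f12 : Commute (u 0 1 2 3) (a 6 4) :=
    TwistedCommute.commute (m := 0) (utw (tw0 0 1 6 4 (by simp)) (tw0 2 3 6 4 (by simp))) hz2
  have f22 : TwistedCommute z 1 (u 0 1 4 5) (a 6 4) :=
    utw (tw0 0 1 6 4 (by simp)) ((tw1 6 4 5 (by simp)).symm hz2)
  have f32 : Commute (u 0 2 6 4) (a 6 4) :=
    TwistedCommute.commute (m := 0) (utw (tw0 0 2 6 4 (by simp)) (tws 6 4)) hz2
  have f13 : Commute (u 0 1 2 3) (a 2 3) :=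
    TwistedCommute.commute (m := 0) (utw (tw0 0 1 2 3 (by simp)) (tws 2 3)) hz2
  have f23 : Commute (u 0 1 4 5) (a 2 3) :=
    TwistedCommute.commute (m := 0) (utw (tw0 0 1 2 3 (by simp)) (tw0 4 5 2 3 (by simp))) hz2
  have f33 : TwistedCommute z 1 (u 0 2 6 4) (a 2 3) :=
    utw (tw1 0 2 3 (by simp)) (tw0 6 4 2 3 (by simp))
  have sq_apply : ∀ x : V ≃ₗ[ℂ] V, x ^ 2 = 1 → ∀ v, x (x v) = ((1 : ℂ) * 1) • v := fun x hx v ↦ by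
    rw [← LinearEquiv.mul_apply, ← sq, hx, LinearEquiv.coe_one, id, mul_one, one_smul]
  let x : ℕ → V ≃ₗ[ℂ] V := fun i ↦
    if i = 0 then u 0 1 2 3 else if i = 1 then u 0 1 4 5 else u 0 2 6 4
  let y : ℕ → V ≃ₗ[ℂ] V := fun i ↦ if i = 0 then a 2 6 else if i = 1 then a 6 4 else a 2 3
  obtain ⟨U, hU, hWU⟩ := finrank_eq_two_pow_mul W 3 x y (one_ne_zero (α := ℂ))
    (by intro i hi; interval_cases i <;> exact uW _ _ _ _)
    (by intro i hi; interval_cases i <;> exact aW _ _)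
    (by
      intro i hi v _
      interval_cases i
      exacts [sq_apply _ s1 v, sq_apply _ s2 v, sq_apply _ s3 v])
    (by
      intro i hi
      interval_cases i
      exacts [anti _ _ _ f11 (uW _ _ _ _), anti _ _ _ f22 (uW _ _ _ _), anti _ _ _ f33 (uW _ _ _ _)])
    (by
      intro i hi j hj
      interval_cases i <;> interval_cases j
      exacts [Commute.refl _, c12, c13, c12.symm, Commute.refl _, c23, c13.symm, c23.symm,
        Commute.refl _])
    (by
      intro i hi j hj hij
      interval_cases i <;> interval_cases j
      exacts [absurd rfl hij, f12, f13, f21, absurd rfl hij, f23, f31, f32, absurd rfl hij])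
  have hWpos : 0 < Module.finrank ℂ W := by
    rw [Module.finrank_pos_iff, Submodule.nontrivial_iff_ne_bot]
    exact fun hb ↦ hv0 (by simpa [hb] using (memW v).2 hv)
  have hle := W.finrank_le
  have hUpos : 0 < Module.finrank ℂ U :=
    Nat.pos_of_ne_zero fun h0 ↦ by rw [h0, mul_zero] at hWU; omega
  rw [Module.finrank_pos_iff, Submodule.nontrivial_iff_ne_bot] at hUpos
  obtain ⟨p, hp, hp0⟩ := (Submodule.ne_bot_iff U).1 hUpos
  -- Adjoining `z` with eigenvalue `-1` presents `U` as a joint eigenspace in all of `V`, where the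
  -- form is known to be nondegenerate.
  let b : Fin 4 → V ≃ₗ[ℂ] V := ![z, u 0 1 2 3, u 0 1 4 5, u 0 2 6 4]
  let χ : Fin 4 → ℂ := ![-1, 1, 1, 1]
  have hUb : ∀ v, v ∈ U ↔ v ∈ jointEigenspace b χ := fun v ↦ by
    rw [hU, memW, mem_jointEigenspace]
    constructor
    · rintro ⟨h0, hx⟩ i
      fin_cases i
      · simpa [b, χ] using h0
      · exact hx 0 (by simp)
      · exact hx 1 (by simp)
      · exact hx 2 (by simp)
    · intro hb
      refine ⟨by simpa [b, χ] using hb 0, fun i hi ↦ ?_⟩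
      interval_cases i
      exacts [hb 1, hb 2, hb 3]
  have zω : ∀ v w, ω (z v) (z w) = ω v w := fun v w ↦ by
    rw [← asq 0 1 (by simp), sq, LinearEquiv.mul_apply, LinearEquiv.mul_apply,
      aω, aω]
  obtain ⟨q, hq, hpq⟩ := exists_mem_jointEigenspace_form_ne_zero ω hω b
    (by intro i; fin_cases i; exacts [zω, uω _ _ _ _, uω _ _ _ _, uω _ _ _ _])
    (by
      intro i j
      fin_cases i <;> fin_cases j
      exacts [Commute.refl _, uz _ _ _ _, uz _ _ _ _, uz _ _ _ _,
        (uz _ _ _ _).symm, Commute.refl _, c12, c13,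
        (uz _ _ _ _).symm, c12.symm, Commute.refl _, c23,
        (uz _ _ _ _).symm, c13.symm, c23.symm, Commute.refl _])
    (by intro i; fin_cases i; exacts [hz2, s1, s2, s3]) χ
    (by intro i; fin_cases i <;> simp [χ]) ((hUb p).1 hp) hp0
  -- One hyperbolic pair in `U` gives `dim U ≥ 2`, hence `dim W ≥ 2 ^ 3 * 2`.
  have h2 := two_mul_card_le_finrank_of_hyperbolic_pairs (τ := Unit)
    (ω.compl₁₂ U.subtype U.subtype) (fun _ ↦ ⟨p, hp⟩) (fun _ ↦ ⟨q, (hUb q).2 hq⟩)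
    (fun _ _ ↦ halt p) (fun _ _ ↦ halt q) (fun _ _ hne ↦ absurd rfl hne)
    (fun _ _ hne ↦ absurd rfl hne) (fun _ ↦ hpq)
    (fun _ ↦ fun h0 ↦ hpq (by rw [← halt.neg q p]; simpa using h0))
  rw [Fintype.card_unit] at h2
  omega

end IsQuarterTurnFamily

/-! ### Trivial full turn: commuting half turns permuted by transpositions -/

namespace IsQuarterTurnFamily

section Group

variable {ι G : Type*} [Group G] {s : ι → ι → G}

theorem half_turn_sq_eq_one (h : IsQuarterTurnFamily s)
    (hz : ∀ i j, i ≠ j → (s i j ^ 2) ^ 2 = 1) (i j : ι) : (s i j ^ 2) ^ 2 = 1 := by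
  by_cases hij : i = j
  · rw [hij, h.self, one_pow, one_pow]
  · exact hz i j hij

theorem half_turn_symm (h : IsQuarterTurnFamily s)
    (hz : ∀ i j, i ≠ j → (s i j ^ 2) ^ 2 = 1) (i j : ι) : s j i ^ 2 = s i j ^ 2 := by
  rw [h.sq_symm i j, inv_eq_iff_mul_eq_one, ← sq, h.half_turn_sq_eq_one hz]

/-- Triviality of the full turn extends `sq_mul_sq` to coinciding indices, which spares later case
distinctions. -/
theorem half_turn_mul (h : IsQuarterTurnFamily s)
    (hz : ∀ i j, i ≠ j → (s i j ^ 2) ^ 2 = 1) (i j k : ι) :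
    s i k ^ 2 * s i j ^ 2 = s j k ^ 2 := by
  by_cases hij : i = j
  · rw [hij, h.self, one_pow, mul_one]
  by_cases hjk : j = k
  · rw [hjk, h.self, ← sq, h.half_turn_sq_eq_one hz, one_pow]
  by_cases hik : i = k
  · rw [hik, h.self, one_pow, one_mul, h.half_turn_symm hz]
  exact h.sq_mul_sq hij hjk hik

/-- Half turns through a common axis `i` have as product the half turn in the third plane, which is
symmetric in its indices; and every half turn is a product of two through `i`. -/
theorem half_turn_commute (h : IsQuarterTurnFamily s)
    (hz : ∀ i j, i ≠ j → (s i j ^ 2) ^ 2 = 1) (i j k l : ι) :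
    Commute (s i j ^ 2) (s k l ^ 2) := by
  have hb : ∀ j k, Commute (s i j ^ 2) (s i k ^ 2) := fun j k ↦ by
    rw [Commute, SemiconjBy, h.half_turn_mul hz, h.half_turn_mul hz, h.half_turn_symm hz]
  rw [← h.half_turn_mul hz i k l]
  exact (hb _ _).mul_right (hb _ _)

/-- When the full turn is trivial, a quarter turn permutes the half turns by a transposition. -/
theorem half_turn_mul_quarter_turn [DecidableEq ι] (h : IsQuarterTurnFamily s)
    (hι : ∀ i j : ι, ∃ k, i ≠ k ∧ j ≠ k) (hz : ∀ i j, i ≠ j → (s i j ^ 2) ^ 2 = 1)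
    (p q i j : ι) :
    s i j ^ 2 * s p q = s p q * s (Equiv.swap p q i) (Equiv.swap p q j) ^ 2 := by
  by_cases hpq : p = q
  · rw [hpq, h.self, Equiv.swap_self, mul_one, one_mul]; rfl
  obtain ⟨o, hpo, hqo⟩ := hι p q
  -- An axis `o` fixed by the transposition serves as a base point: general half turns are products
  -- of two through `o`.
  have key : ∀ j, s o j ^ 2 * s p q = s p q * s o (Equiv.swap p q j) ^ 2 := fun j ↦ by
    rw [← eq_mul_inv_iff_mul_eq]
    by_cases hjp : j = p
    · rw [hjp, Equiv.swap_apply_left, h.half_turn_symm hz q o, ← conj_pow,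
        h.conj_eq hpq hqo hpo, h.half_turn_symm hz]
    by_cases hjq : j = q
    · rw [hjq, Equiv.swap_apply_right, h.half_turn_symm hz p o, ← conj_pow,
        h.conj_eq' hpq hqo hpo]
    rw [Equiv.swap_apply_of_ne_of_ne hjp hjq, eq_mul_inv_iff_mul_eq]
    exact (h.comm o j p q hpo.symm hqo.symm hjp hjq).pow_left 2
  rw [← h.half_turn_mul hz o i j, ← h.half_turn_mul hz o (Equiv.swap p q i), mul_assoc, key,
    ← mul_assoc, key, mul_assoc]

end Group

variable {V : Type*} [AddCommGroup V] [Module ℂ V] {ι : Type*} {s : ι → ι → V ≃ₗ[ℂ] V}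

/-- If the full turn acts trivially on a symplectic space of dimension less than `2k + 4`, then so do
the half turns. -/
theorem half_turn_eq_one [FiniteDimensional ℂ V] [Fintype ι] (h : IsQuarterTurnFamily s)
    (k : ℕ) (hk : 3 ≤ k) (hcard : Fintype.card ι = 2 * k + 1)
    (hι : ∀ i j : ι, ∃ k, i ≠ k ∧ j ≠ k) (hz : ∀ i j, i ≠ j → (s i j ^ 2) ^ 2 = 1)
    (ω : V →ₗ[ℂ] V →ₗ[ℂ] ℂ) (hω : ∀ v, v ≠ 0 → ∃ w, ω v w ≠ 0) (halt : ω.IsAlt)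
    (hs : ∀ i j v w, ω (s i j v) (s i j w) = ω v w) (hV : Module.finrank ℂ V < 2 * k + 4)
    (i j : ι) : s i j ^ 2 = 1 := by
  classical
  by_contra hne
  let a : ι × ι → V ≃ₗ[ℂ] V := fun p ↦ s p.1 p.2 ^ 2
  have acomm : ∀ p q, Commute (a p) (a q) := fun p q ↦ h.half_turn_commute hz _ _ _ _
  have asq : ∀ p, a p ^ 2 = 1 := fun p ↦ h.half_turn_sq_eq_one hz _ _
  have aω : ∀ p v w, ω (a p v) (a p w) = ω v w := fun p v w ↦ by
    simp only [a]
    rw [sq, LinearEquiv.mul_apply, LinearEquiv.mul_apply, hs, hs]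
  obtain ⟨u, hu⟩ : ∃ u, (s i j ^ 2) u ≠ u := by
    by_contra! hall
    exact hne (LinearEquiv.ext hall)
  have hu' : a (i, j) ((s i j ^ 2) u - u) = (-1 : ℂ) • ((s i j ^ 2) u - u) := by
    simp only [a]
    rw [map_sub, ← LinearEquiv.mul_apply, ← sq, h.half_turn_sq_eq_one hz, LinearEquiv.coe_one, id,
      neg_one_smul, neg_sub]
  obtain ⟨v, hv0, hvij, hv⟩ := exists_jointEigenvector a acomm asq (sub_ne_zero.2 hu) (i, j) (-1) hu'
  -- Take `η p` to be the sign of the half turn in the plane `i p`; `half_turn_mul` determines the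
  -- sign in every other plane as a product.
  have hsign : ∃ η : ι → ℂ, (∀ p, η p = 1 ∨ η p = -1) ∧
      v ∈ jointEigenspace a (fun p ↦ η p.1 * η p.2) := by
    choose c hc using fun p ↦ (show ∃ c : ℂ, (c = 1 ∨ c = -1) ∧ a (i, p) v = c • v by
      rcases hv (i, p) with h1 | h1
      · exact ⟨1, Or.inl rfl, by rw [h1, one_smul]⟩
      · exact ⟨-1, Or.inr rfl, by rw [h1, neg_one_smul]⟩)
    refine ⟨c, fun p ↦ (hc p).1, mem_jointEigenspace.2 fun ⟨p, q⟩ ↦ ?_⟩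
    have : a (p, q) = a (i, q) * a (i, p) := (h.half_turn_mul hz i p q).symm
    rw [this, LinearEquiv.mul_apply, (hc p).2, map_smul, (hc q).2, smul_smul]
  -- Only products of two signs matter, so `η` may be negated to make `1` the majority among `2k+1`
  -- signs.
  have hsign' : ∃ η : ι → ℂ, (∀ p, η p = 1 ∨ η p = -1) ∧
      v ∈ jointEigenspace a (fun p ↦ η p.1 * η p.2) ∧
      k + 1 ≤ (Finset.univ.filter fun p ↦ η p = 1).card := by
    obtain ⟨η, h1, h2⟩ := hsign
    by_cases hc : k + 1 ≤ (Finset.univ.filter fun p ↦ η p = 1).card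
    · exact ⟨η, h1, h2, hc⟩
    · refine ⟨-η, fun p ↦ ?_, ?_, ?_⟩
      · rcases h1 p with hp | hp <;> simp [hp]
      · simpa using h2
      · have h3 := Finset.card_filter_add_card_filter_not (s := Finset.univ) (fun p ↦ η p = 1)
        rw [Finset.card_univ, hcard] at h3
        have h4 : (Finset.univ.filter fun p ↦ ¬ η p = 1) ⊆
            Finset.univ.filter fun p ↦ (-η) p = 1 := fun p hp ↦ by
          rw [Finset.mem_filter] at hp ⊢
          refine ⟨hp.1, ?_⟩
          rw [Pi.neg_apply, (h1 p).resolve_left hp.2, neg_neg]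
        have := Finset.card_le_card h4
        omega
  obtain ⟨η, hη, hvη, hcardη⟩ := hsign'
  obtain ⟨o, ho⟩ : ∃ o, η o = -1 := by
    by_contra! hall
    have h1 := mem_jointEigenspace.1 hvη (i, j)
    simp only [(hη _).resolve_right (hall _), mul_one, one_smul] at h1
    rw [hvij, neg_one_smul] at h1
    have h2 : (2 : ℂ) • v = 0 := by
      rw [two_smul]; nth_rewrite 1 [← h1]; exact neg_add_cancel v
    exact hv0 ((smul_eq_zero.1 h2).resolve_left two_ne_zero)
  -- Each `t ∈ T` stands for the transposition of `o` and `t`; including `o` itself keeps the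
  -- original character and brings the count to `k + 2`.
  set T := insert o (Finset.univ.filter fun p ↦ η p = 1) with hT
  have hTcard : k + 2 ≤ T.card := by
    rw [hT, Finset.card_insert_of_notMem]
    · omega
    · simp only [Finset.mem_filter, Finset.mem_univ, true_and, ho]
      norm_num
  have memT : ∀ t ∈ T, t = o ∨ η t = 1 := fun t ht ↦ by simpa [hT] using ht
  let χ : ι → ι × ι → ℂ := fun t p ↦ η (Equiv.swap o t p.1) * η (Equiv.swap o t p.2)
  have hηsq : ∀ p, η p * η p = 1 := fun p ↦ by rcases hη p with hp | hp <;> simp [hp]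
  have hχsq : ∀ t p, χ t p * χ t p = 1 := fun t p ↦ by
    simp only [χ]
    rw [mul_mul_mul_comm, hηsq, hηsq, one_mul]
  have hmem : ∀ t, s o t v ∈ jointEigenspace a (χ t) := fun t ↦ by
    refine mem_jointEigenspace.2 fun ⟨p, q⟩ ↦ ?_
    simp only [a, χ]
    rw [← LinearEquiv.mul_apply, h.half_turn_mul_quarter_turn hι hz, LinearEquiv.mul_apply]
    have := mem_jointEigenspace.1 hvη (Equiv.swap o t p, Equiv.swap o t q)
    simp only [a] at this
    rw [this, map_smul]
  -- At least `k + 1 > 2` indices have sign `1`, so one of them, `w`, avoids `t` and `t'`. On the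
  -- plane `t w` the two characters take the values `-1` and `1`.
  have hdist : ∀ t ∈ T, ∀ t' ∈ T, t ≠ t' → ∃ p, χ t p * χ t' p ≠ 1 := fun t ht t' ht' htt' ↦ by
    obtain ⟨w, hw, hwt⟩ : ∃ w ∈ Finset.univ.filter (fun p ↦ η p = 1), w ∉ ({t, t'} : Finset ι) := by
      apply Finset.exists_mem_notMem_of_card_lt_card
      have := Finset.card_le_two (a := t) (b := t')
      omega
    simp only [Finset.mem_filter, Finset.mem_univ, true_and] at hw
    simp only [Finset.mem_insert, Finset.mem_singleton, not_or] at hwt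
    have hwo : w ≠ o := fun hwo ↦ by rw [hwo, ho] at hw; norm_num at hw
    refine ⟨(t, w), ?_⟩
    simp only [χ]
    rw [Equiv.swap_apply_right, Equiv.swap_apply_of_ne_of_ne hwo hwt.1,
      Equiv.swap_apply_of_ne_of_ne hwo hwt.2, hw, ho]
    have h1 : η (Equiv.swap o t' t) = 1 := by
      by_cases hto : t = o
      · rw [hto, Equiv.swap_apply_left]
        exact (memT t' ht').resolve_left fun h0 ↦ htt' (hto.trans h0.symm)
      · rw [Equiv.swap_apply_of_ne_of_ne hto htt']
        exact (memT t ht).resolve_left hto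
    rw [h1]
    norm_num
  have horth : ∀ t ∈ T, ∀ t' ∈ T, t ≠ t' → ∀ x ∈ jointEigenspace a (χ t),
      ∀ y ∈ jointEigenspace a (χ t'), ω x y = 0 := fun t ht t' ht' htt' x hx y hy ↦ by
    obtain ⟨p, hp⟩ := hdist t ht t' ht' htt'
    have h1 := aω p x y
    rw [mem_jointEigenspace.1 hx, mem_jointEigenspace.1 hy, map_smul, map_smul,
      LinearMap.smul_apply, smul_smul, smul_eq_mul, mul_comm (χ t' p)] at h1
    by_contra h0
    exact hp (mul_right_cancel₀ h0 (h1.trans (one_mul _).symm))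
  choose w hw hvw using fun t ↦ exists_mem_jointEigenspace_form_ne_zero ω hω a aω acomm asq (χ t)
    (hχsq t) (hmem t) ((map_ne_zero_iff _ (s o t).injective).2 hv0)
  have hle := two_mul_card_le_finrank_of_hyperbolic_pairs (τ := T) ω (fun t ↦ s o t v)
    (fun t ↦ w t)
    (fun t t' ↦ by
      by_cases htt' : t = t'
      · rw [htt']; exact halt _
      · exact horth t t.2 t' t'.2 (fun h0 ↦ htt' (Subtype.ext h0)) _ (hmem t) _ (hmem t'))
    (fun t t' ↦ by
      by_cases htt' : t = t'
      · rw [htt']; exact halt _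
      · exact horth t t.2 t' t'.2 (fun h0 ↦ htt' (Subtype.ext h0)) _ (hw t) _ (hw t'))
    (fun t t' htt' ↦
      horth t t.2 t' t'.2 (fun h0 ↦ htt' (Subtype.ext h0)) _ (hmem t) _ (hw t'))
    (fun t t' htt' ↦
      horth t t.2 t' t'.2 (fun h0 ↦ htt' (Subtype.ext h0)) _ (hw t) _ (hmem t'))
    (fun t ↦ hvw t)
    (fun t h0 ↦ hvw t (by rw [← halt.neg, h0, neg_zero]))
  rw [Fintype.card_coe] at hle
  omega

/-- In a symplectic representation of dimension `2k + 2` of the quarter turns in dimension `2k + 1`,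
where `k ≥ 3`, the half turns act trivially. -/
theorem sq_eq_one_of_finrank_eq [FiniteDimensional ℂ V] {k : ℕ} (hk : 3 ≤ k)
    {s : Fin (2 * k + 1) → Fin (2 * k + 1) → V ≃ₗ[ℂ] V} (h : IsQuarterTurnFamily s)
    (ω : V →ₗ[ℂ] V →ₗ[ℂ] ℂ) (hω : ∀ v, v ≠ 0 → ∃ w, ω v w ≠ 0) (halt : ω.IsAlt)
    (hs : ∀ i j v w, ω (s i j v) (s i j w) = ω v w) (hV : Module.finrank ℂ V = 2 * k + 2)
    (i j : Fin (2 * k + 1)) : s i j ^ 2 = 1 := by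
  have hι : ∀ i j : Fin (2 * k + 1), ∃ k, i ≠ k ∧ j ≠ k := fun i j ↦ by
    obtain ⟨l, -, hl⟩ := Finset.exists_mem_notMem_of_card_lt_card
      (s := ({i, j} : Finset (Fin (2 * k + 1)))) (t := Finset.univ) (by
        have := Finset.card_le_two (a := i) (b := j)
        rw [Finset.card_univ, Fintype.card_fin]
        omega)
    simp only [Finset.mem_insert, Finset.mem_singleton, not_or] at hl
    exact ⟨l, Ne.symm hl.1, Ne.symm hl.2⟩
  obtain ⟨z, hz2, hz⟩ := h.exists_full_turn hι
  have he : ∀ m n, m < 2 * k + 1 → n < 2 * k + 1 → m ≠ n →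
      Fin.ofNat (2 * k + 1) m ≠ Fin.ofNat (2 * k + 1) n := fun m n hm hn hmn heq ↦ hmn (by
    have := congrArg Fin.val heq
    simpa [Fin.val_ofNat, Nat.mod_eq_of_lt hm, Nat.mod_eq_of_lt hn] using this)
  have hno : ∀ v, z v = -v → v = 0 := fun v hv ↦ by
    by_contra hv0
    -- The bound `2 ^ k` is too weak exactly at `k = 3`, where `2 ^ k = 2 * k + 2`.
    rcases hk.eq_or_lt with rfl | hk
    · have := h.sixteen_le_finrank_of_full_turn hz2 hz _ he ω hω halt hs hv hv0
      omega
    · have h1 := h.two_pow_le_finrank_of_full_turn hz2 hz k _ he hv hv0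
      have h2 : ∀ n, 4 ≤ n → 2 * n + 2 < 2 ^ n := fun n hn ↦ by
        induction n, hn using Nat.le_induction with
        | base => norm_num
        | succ n hn ih => rw [pow_succ]; omega
      have := h2 k hk
      omega
  have hz1 : z = 1 := LinearEquiv.ext fun v ↦ by
    have := hno (z v - v) (by
      rw [map_sub, ← LinearEquiv.mul_apply, ← sq, hz2, LinearEquiv.coe_one, id, neg_sub])
    simpa [sub_eq_zero] using this
  subst hz1
  exact h.half_turn_eq_one k hk (Fintype.card_fin _) hι hz ω hω halt hs (by omega) i j

end IsQuarterTurnFamily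

/-! ### Exponentials of rotations -/

/-- If `ad A` acts as an infinitesimal rotation of the plane spanned by `B` and `C`, then
conjugation by `exp (t • A)` rotates this plane by the angle `t`. -/
theorem exp_smul_mul_eq_of_rotation {𝔸 : Type*} [NormedRing 𝔸] [NormedAlgebra ℝ 𝔸]
    [CompleteSpace 𝔸] {A B C : 𝔸} (hB : A * B - B * A = C) (hC : A * C - C * A = -B) (t : ℝ) :
    NormedSpace.exp (t • A) * B =
      (Real.cos t • B + Real.sin t • C) * NormedSpace.exp (t • A) := by
  let : NormedAlgebra ℚ 𝔸 := NormedAlgebra.restrictScalars ℚ ℝ 𝔸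
  -- Undoing the rotation by conjugation should return `B` for every `t`; the bracket relations make
  -- the derivative vanish.
  let F : ℝ → 𝔸 := fun t ↦ NormedSpace.exp (t • (-A)) * (Real.cos t • B + Real.sin t • C) *
    NormedSpace.exp (t • A)
  have hAB : A * B = B * A + C := by rw [← hB]; abel
  have hAC : A * C = C * A - B := by rw [sub_eq_add_neg, ← hC]; abel
  have hF : ∀ t, HasDerivAt F 0 t := fun t ↦ by
    have h1 := hasDerivAt_exp_smul_const (𝕂 := ℝ) (-A) t
    have h2 := hasDerivAt_exp_smul_const' (𝕂 := ℝ) A t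
    have h3 := ((Real.hasDerivAt_cos t).smul_const B).add ((Real.hasDerivAt_sin t).smul_const C)
    have h4 := (h1.mul h3).mul h2
    refine h4.congr_deriv ?_
    have hin : -A * (Real.cos t • B + Real.sin t • C) + (-Real.sin t • B + Real.cos t • C) +
        (Real.cos t • B + Real.sin t • C) * A = 0 := by
      simp only [neg_mul, mul_add, add_mul, mul_smul_comm, smul_mul_assoc, hAB, hAC]
      module
    calc _ = NormedSpace.exp (t • (-A)) * (-A * (Real.cos t • B + Real.sin t • C) +
          (-Real.sin t • B + Real.cos t • C) + (Real.cos t • B + Real.sin t • C) * A) *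
          NormedSpace.exp (t • A) := by
          simp only [Pi.mul_apply, Pi.add_apply, mul_add, add_mul, mul_assoc]
      _ = 0 := by rw [hin, mul_zero, zero_mul]
  have hconst := is_const_of_deriv_eq_zero (fun t ↦ (hF t).differentiableAt)
    (fun t ↦ (hF t).deriv) t 0
  simp only [F, Real.cos_zero, Real.sin_zero, one_smul, zero_smul, add_zero, NormedSpace.exp_zero,
    one_mul, mul_one] at hconst
  have hinv : NormedSpace.exp (t • A) * NormedSpace.exp (t • (-A)) = 1 := by
    rw [← NormedSpace.exp_add_of_commute (by rw [smul_neg]; exact (Commute.refl _).neg_right),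
      smul_neg, add_neg_cancel, NormedSpace.exp_zero]
  nth_rewrite 1 [← hconst]
  rw [← mul_assoc, ← mul_assoc, hinv, one_mul]

theorem Matrix.eq_zero_of_eq_neg {m n : Type*} {A : Matrix m n ℂ} (h : A = -A) : A = 0 := by
  ext i j
  exact self_eq_neg.1 (congrFun (congrFun h i) j)

section MatrixExp

variable {m : Type*} [Fintype m] [DecidableEq m]

theorem Matrix.mul_exp_eq_of_mul_eq {U A B : Matrix m m ℂ} (hU : IsUnit U)
    (h : U * A = B * U) : U * NormedSpace.exp A = NormedSpace.exp B * U := by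
  have hU' := (Matrix.isUnit_iff_isUnit_det _).1 hU
  have h1 : B = U * A * U⁻¹ := by
    rw [h, Matrix.mul_nonsing_inv_cancel_right _ _ hU']
  rw [h1, Matrix.exp_conj U A hU, Matrix.nonsing_inv_mul_cancel_right _ _ hU']

theorem Matrix.exp_half_pi_mul_of_rotation {A B C : Matrix m m ℂ} (hB : A * B - B * A = C)
    (hC : A * C - C * A = -B) :
    NormedSpace.exp ((Real.pi / 2) • A) * B = C * NormedSpace.exp ((Real.pi / 2) • A) := by
  have h : NormedSpace.exp ((Real.pi / 2) • A) * B =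
      (Real.cos (Real.pi / 2) • B + Real.sin (Real.pi / 2) • C) *
        NormedSpace.exp ((Real.pi / 2) • A) := by
    open scoped Norms.Operator in
    exact exp_smul_mul_eq_of_rotation hB hC _
  rwa [Real.cos_pi_div_two, Real.sin_pi_div_two, zero_smul, zero_add, one_smul] at h

theorem Matrix.exp_mul_exp_neg (A : Matrix m m ℂ) :
    NormedSpace.exp A * NormedSpace.exp (-A) = 1 := by
  rw [← Matrix.exp_add_of_commute _ _ (Commute.refl A).neg_right, add_neg_cancel,
    NormedSpace.exp_zero]

theorem Matrix.exp_neg_mul_exp (A : Matrix m m ℂ) :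
    NormedSpace.exp (-A) * NormedSpace.exp A = 1 := by
  simpa using Matrix.exp_mul_exp_neg (-A)

/-- The linear automorphism `exp A`. -/
noncomputable def Matrix.expEquiv (A : Matrix m m ℂ) : (m → ℂ) ≃ₗ[ℂ] (m → ℂ) :=
  Matrix.toLin'OfInv (Matrix.exp_neg_mul_exp A) (Matrix.exp_mul_exp_neg A)

theorem Matrix.expEquiv_apply (A : Matrix m m ℂ) (v : m → ℂ) :
    A.expEquiv v = NormedSpace.exp A *ᵥ v := by
  ext i
  simp [Matrix.expEquiv]

theorem Matrix.expEquiv_mul_apply (A B : Matrix m m ℂ) (v : m → ℂ) :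
    (A.expEquiv * B.expEquiv) v = (NormedSpace.exp A * NormedSpace.exp B) *ᵥ v := by
  rw [LinearEquiv.mul_apply, Matrix.expEquiv_apply, Matrix.expEquiv_apply, Matrix.mulVec_mulVec]

end MatrixExp

theorem LieAlgebra.Symplectic.mem_sp {l R : Type*} [Fintype l] [DecidableEq l] [CommRing R]
    {A : Matrix (l ⊕ l) (l ⊕ l) R} :
    A ∈ LieAlgebra.Symplectic.sp l R ↔ Aᵀ * Matrix.J l R = Matrix.J l R * (-A) := by
  rw [LieAlgebra.Symplectic.sp, mem_skewAdjointMatricesLieSubalgebra,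
    mem_skewAdjointMatricesSubmodule]
  rfl

theorem Matrix.isUnit_J (l : Type*) [Fintype l] [DecidableEq l] : IsUnit (Matrix.J l ℂ) :=
  (Matrix.isUnit_iff_isUnit_det _).2 (Matrix.isUnit_det_J l ℂ)

/-- The exponential of an element of the symplectic Lie algebra is symplectic. -/
theorem Matrix.exp_transpose_mul_J_mul_exp {l : Type*} [Fintype l] [DecidableEq l]
    {A : Matrix (l ⊕ l) (l ⊕ l) ℂ} (hA : A ∈ LieAlgebra.Symplectic.sp l ℂ) :
    (NormedSpace.exp A)ᵀ * Matrix.J l ℂ * NormedSpace.exp A = Matrix.J l ℂ := by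
  rw [LieAlgebra.Symplectic.mem_sp] at hA
  rw [← Matrix.exp_transpose, ← Matrix.mul_exp_eq_of_mul_eq (Matrix.isUnit_J l) hA.symm,
    mul_assoc, Matrix.exp_neg_mul_exp, mul_one]

/-! ### Symplectic matrices with the commutation relations of the orthogonal Lie algebra -/

/-- A family of matrices satisfying the commutation relations between the infinitesimal rotations
in the coordinate planes. -/
structure IsRotationFamily {ι m : Type*} [Fintype m] (E : ι → ι → Matrix m m ℂ) : Prop where
  skew : ∀ i j, E j i = -E i j
  rot : ∀ i j k, i ≠ j → j ≠ k → i ≠ k → E i j * E j k - E j k * E i j = E i k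
  comm : ∀ i j k l, i ≠ k → i ≠ l → j ≠ k → j ≠ l → Commute (E i j) (E k l)

namespace IsRotationFamily

variable {ι m : Type*} [Fintype m] {E : ι → ι → Matrix m m ℂ}

theorem self (h : IsRotationFamily E) (i : ι) : E i i = 0 :=
  Matrix.eq_zero_of_eq_neg (h.skew i i)

theorem rot' (h : IsRotationFamily E) {i j k : ι} (hij : i ≠ j) (hjk : j ≠ k) (hik : i ≠ k) :
    E i j * E i k - E i k * E i j = -E j k := by
  rw [← h.rot j i k hij.symm hik hjk, h.skew i j]
  noncomm_ring

variable [DecidableEq m]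

/-- `ad (E i j)` is an infinitesimal rotation on the pair `E j k`, `E i k`; at angle `π/2` it
carries the first to the second. -/
theorem exp_mul (h : IsRotationFamily E) {i j k : ι} (hij : i ≠ j) (hjk : j ≠ k) (hik : i ≠ k) :
    NormedSpace.exp ((Real.pi / 2) • E i j) * E j k =
      E i k * NormedSpace.exp ((Real.pi / 2) • E i j) :=
  Matrix.exp_half_pi_mul_of_rotation (h.rot i j k hij hjk hik) (h.rot' hij hjk hik)

theorem exp_mul' (h : IsRotationFamily E) {i j k : ι} (hij : i ≠ j) (hjk : j ≠ k) (hik : i ≠ k) :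
    NormedSpace.exp ((Real.pi / 2) • E i j) * E i k =
      -E j k * NormedSpace.exp ((Real.pi / 2) • E i j) := by
  refine Matrix.exp_half_pi_mul_of_rotation (h.rot' hij hjk hik) ?_
  rw [← h.rot i j k hij hjk hik]
  noncomm_ring

/-- Intertwining relations between the `E i j` pass to their exponentials, so the action of a
quarter turn on the generators becomes its action on the other quarter turns. -/
theorem isQuarterTurnFamily (h : IsRotationFamily E) :
    IsQuarterTurnFamily fun i j ↦ ((Real.pi / 2) • E i j).expEquiv where
  self i := LinearEquiv.ext fun v ↦ by
    rw [Matrix.expEquiv_apply, h.self, smul_zero, NormedSpace.exp_zero, Matrix.one_mulVec,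
      LinearEquiv.coe_one, id]
  inv i j := by
    rw [eq_inv_iff_mul_eq_one]
    refine LinearEquiv.ext fun v ↦ ?_
    rw [Matrix.expEquiv_mul_apply, h.skew i j, smul_neg, Matrix.exp_neg_mul_exp, Matrix.one_mulVec,
      LinearEquiv.coe_one, id]
  rot i j k hij hjk hik := LinearEquiv.ext fun v ↦ by
    rw [Matrix.expEquiv_mul_apply, Matrix.expEquiv_mul_apply, Matrix.mul_exp_eq_of_mul_eq
      (Matrix.isUnit_exp _)]
    rw [mul_smul_comm, h.exp_mul hij hjk hik, smul_mul_assoc]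
  comm i j k l hik hil hjk hjl := LinearEquiv.ext fun v ↦ by
    rw [Matrix.expEquiv_mul_apply, Matrix.expEquiv_mul_apply,
      ← Matrix.exp_add_of_commute, ← Matrix.exp_add_of_commute, add_comm]
    · exact (((h.comm i j k l hik hil hjk hjl).smul_left _).smul_right _).symm
    · exact ((h.comm i j k l hik hil hjk hjl).smul_left _).smul_right _

/-- The half turn in the plane `i j` is trivial by the dimension bound, yet conjugation by it sends
`E j l` to `-E j l`. -/
theorem eq_zero {k : ℕ} (hk : 3 ≤ k)
    {E : Fin (2 * k + 1) → Fin (2 * k + 1) →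
      Matrix (Fin (k + 1) ⊕ Fin (k + 1)) (Fin (k + 1) ⊕ Fin (k + 1)) ℂ}
    (h : IsRotationFamily E) (hE : ∀ i j, E i j ∈ LieAlgebra.Symplectic.sp (Fin (k + 1)) ℂ)
    {i j l : Fin (2 * k + 1)} (hij : i ≠ j) (hjl : j ≠ l) (hil : i ≠ l) : E j l = 0 := by
  have hJ := Matrix.J_squared (Fin (k + 1)) ℂ
  have hsp : ∀ i j, (Real.pi / 2) • E i j ∈ LieAlgebra.Symplectic.sp (Fin (k + 1)) ℂ := fun i j ↦ by
    have e : (Real.pi / 2) • E i j = ((Real.pi / 2 : ℝ) : ℂ) • E i j := by ext; simp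
    rw [e]
    exact (LieAlgebra.Symplectic.sp (Fin (k + 1)) ℂ).smul_mem _ (hE i j)
  have key := h.isQuarterTurnFamily.sq_eq_one_of_finrank_eq hk
    (Matrix.toLinearMap₂' ℂ (Matrix.J (Fin (k + 1)) ℂ))
    (fun v hv ↦ by
      by_contra! hall
      refine hv ?_
      have h1 : v ᵥ* Matrix.J (Fin (k + 1)) ℂ = 0 := by
        refine dotProduct_eq_zero_iff.1 fun w ↦ ?_
        rw [← Matrix.dotProduct_mulVec, ← Matrix.toLinearMap₂'_apply', hall]
      have h2 := congrArg (fun u ↦ u ᵥ* Matrix.J (Fin (k + 1)) ℂ) h1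
      simpa [Matrix.vecMul_vecMul, hJ, Matrix.vecMul_neg] using h2)
    (fun v ↦ by
      rw [Matrix.toLinearMap₂'_apply']
      have h1 : v ⬝ᵥ Matrix.J (Fin (k + 1)) ℂ *ᵥ v = -(v ⬝ᵥ Matrix.J (Fin (k + 1)) ℂ *ᵥ v) := by
        nth_rewrite 1 [Matrix.dotProduct_mulVec, ← Matrix.mulVec_transpose, Matrix.J_transpose,
          dotProduct_comm]
        rw [Matrix.neg_mulVec, dotProduct_neg]
      exact self_eq_neg.1 h1)
    (fun i j v w ↦ by
      rw [Matrix.toLinearMap₂'_apply', Matrix.toLinearMap₂'_apply', Matrix.expEquiv_apply,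
        Matrix.expEquiv_apply, Matrix.mulVec_mulVec, Matrix.dotProduct_mulVec,
        ← Matrix.vecMul_transpose, Matrix.vecMul_vecMul, ← mul_assoc,
        Matrix.exp_transpose_mul_J_mul_exp (hsp i j), ← Matrix.dotProduct_mulVec])
    (by rw [Module.finrank_fintype_fun_eq_card]; simp; omega) i j
  have hone : NormedSpace.exp ((Real.pi / 2) • E i j) * NormedSpace.exp ((Real.pi / 2) • E i j) =
      1 := by
    refine Matrix.ext_of_mulVec_single fun a ↦ ?_
    rw [← Matrix.expEquiv_mul_apply, ← sq, key, LinearEquiv.coe_one, id, Matrix.one_mulVec]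
  refine Matrix.eq_zero_of_eq_neg ?_
  calc E j l = NormedSpace.exp ((Real.pi / 2) • E i j) *
        (NormedSpace.exp ((Real.pi / 2) • E i j) * E j l) := by
        rw [← mul_assoc, hone, one_mul]
    _ = -E j l * (NormedSpace.exp ((Real.pi / 2) • E i j) *
        NormedSpace.exp ((Real.pi / 2) • E i j)) := by
        rw [h.exp_mul hij hjl hil, ← mul_assoc, h.exp_mul' hij hjl hil, mul_assoc]
    _ = -E j l := by rw [hone, mul_one]

end IsRotationFamily

/-! ### Generators of the orthogonal Lie algebra -/

namespace LieAlgebra.Orthogonal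

variable {n R : Type*} [Fintype n] [DecidableEq n] [CommRing R]

/-- The infinitesimal rotation in the plane of the coordinates `i` and `j`. -/
def rotGen (R : Type*) [CommRing R] (i j : n) : so n R :=
  ⟨Matrix.single i j 1 - Matrix.single j i 1, by simp⟩

theorem rotGen_skew (i j : n) : rotGen R j i = -rotGen R i j :=
  Subtype.ext (neg_sub _ _).symm

theorem rotGen_lie_rot {i j k : n} (hij : i ≠ j) (hjk : j ≠ k) (hik : i ≠ k) :
    ⁅rotGen R i j, rotGen R j k⁆ = rotGen R i k := by
  refine Subtype.ext ?_
  rw [LieSubalgebra.coe_bracket, Ring.lie_def]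
  simp [rotGen, mul_sub, sub_mul, hij, hij.symm, hjk, hjk.symm, hik, hik.symm]

theorem rotGen_lie_disjoint {i j k l : n} (hik : i ≠ k) (hil : i ≠ l) (hjk : j ≠ k)
    (hjl : j ≠ l) : ⁅rotGen R i j, rotGen R k l⁆ = 0 := by
  refine Subtype.ext ?_
  rw [LieSubalgebra.coe_bracket, Ring.lie_def]
  simp [rotGen, mul_sub, sub_mul, hik, hil, hjk, hjl, hik.symm, hil.symm, hjk.symm, hjl.symm]

theorem rotGen_ne_zero [Nontrivial R] {i j : n} (hij : i ≠ j) : rotGen R i j ≠ 0 := fun h ↦ by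
  have := congrFun (congrFun (congrArg Subtype.val h) i) j
  simp [rotGen, hij] at this

/-- The images of the generators under a representation by complex matrices. -/
theorem isRotationFamily_of_hom {m : Type*} [Fintype m]
    (φ : so n R →+ Matrix m m ℂ) (hφ : ∀ x y, φ ⁅x, y⁆ = φ x * φ y - φ y * φ x) :
    IsRotationFamily fun i j ↦ φ (rotGen R i j) where
  skew i j := by rw [rotGen_skew, map_neg]
  rot i j k hij hjk hik := by rw [← hφ, rotGen_lie_rot hij hjk hik]
  comm i j k l hik hil hjk hjl := by
    rw [Commute, SemiconjBy, ← sub_eq_zero, ← hφ, rotGen_lie_disjoint hik hil hjk hjl, map_zero]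

/-- For `k ≥ 3` there is no faithful symplectic representation of dimension `2k + 2`. -/
theorem not_injective_of_mem_sp [Nontrivial R] {k : ℕ} (hk : 3 ≤ k)
    (φ : so (Fin (2 * k + 1)) R →+
      Matrix (Fin (k + 1) ⊕ Fin (k + 1)) (Fin (k + 1) ⊕ Fin (k + 1)) ℂ)
    (hφ : ∀ x y, φ ⁅x, y⁆ = φ x * φ y - φ y * φ x)
    (hsp : ∀ x, φ x ∈ Symplectic.sp (Fin (k + 1)) ℂ) : ¬ Function.Injective φ := fun hinj ↦ by
  let e : Fin 3 → Fin (2 * k + 1) := Fin.castLE (by omega)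
  have he : Function.Injective e := Fin.castLE_injective _
  have h0 := (isRotationFamily_of_hom φ hφ).eq_zero hk (fun _ _ ↦ hsp _)
    (he.ne (show (0 : Fin 3) ≠ 1 by decide)) (he.ne (show (1 : Fin 3) ≠ 2 by decide))
    (he.ne (show (0 : Fin 3) ≠ 2 by decide))
  exact rotGen_ne_zero (he.ne (show (1 : Fin 3) ≠ 2 by decide))
    (hinj (h0.trans (map_zero φ).symm))

theorem not_exists_injective_sp {k : ℕ} (hk : 3 ≤ k) :
    ¬ ∃ f : so (Fin (2 * k + 1)) ℂ →ₗ⁅ℂ⁆ Symplectic.sp (Fin (k + 1)) ℂ, Function.Injective f := by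
  rintro ⟨f, hf⟩
  refine not_injective_of_mem_sp hk
    ((Symplectic.sp (Fin (k + 1)) ℂ).toSubmodule.subtype.toAddMonoidHom.comp
      (f : so (Fin (2 * k + 1)) ℂ →ₗ[ℂ] _).toAddMonoidHom) (fun x y ↦ ?_) (fun x ↦ (f x).2)
    (Subtype.val_injective.comp hf)
  change (f ⁅x, y⁆).1 = _
  rw [LieHom.map_lie]
  rfl

theorem not_exists_injective_compactSp {k : ℕ} (hk : 3 ≤ k) :
    ¬ ∃ f : so (Fin (2 * k + 1)) ℝ →ₗ⁅ℝ⁆ compactSp (k + 1), Function.Injective f := by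
  rintro ⟨f, hf⟩
  refine not_injective_of_mem_sp hk
    ((compactSp (k + 1)).toSubmodule.subtype.toAddMonoidHom.comp
      (f : so (Fin (2 * k + 1)) ℝ →ₗ[ℝ] _).toAddMonoidHom) (fun x y ↦ ?_) (fun x ↦ (f x).2.1)
    (Subtype.val_injective.comp hf)
  change (f ⁅x, y⁆).1 = _
  rw [LieHom.map_lie]
  rfl

end LieAlgebra.Orthogonal

/-! ### The spin representation of `so(5)` -/

theorem LieAlgebra.Symplectic.mem_sp_iff_apply {l R : Type*} [Fintype l] [DecidableEq l]
    [CommRing R] {A : Matrix (l ⊕ l) (l ⊕ l) R} :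
    A ∈ LieAlgebra.Symplectic.sp l R ↔
      (∀ i j, A (.inr i) (.inr j) = -A (.inl j) (.inl i)) ∧
      (∀ i j, A (.inl i) (.inr j) = A (.inl j) (.inr i)) ∧
      (∀ i j, A (.inr i) (.inl j) = A (.inr j) (.inl i)) := by
  obtain ⟨a, b, c, d, rfl⟩ : ∃ a b c d, A = fromBlocks a b c d :=
    ⟨_, _, _, _, (fromBlocks_toBlocks A).symm⟩
  rw [LieAlgebra.Symplectic.mem_sp, Matrix.J, fromBlocks_transpose, fromBlocks_neg,
    fromBlocks_multiply, fromBlocks_multiply, fromBlocks_inj]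
  simp only [← Matrix.ext_iff]
  simp
  constructor
  · rintro ⟨h1, -, h3, h4⟩
    exact ⟨fun i j ↦ h3 j i, fun i j ↦ h4 j i, fun i j ↦ h1 j i⟩
  · rintro ⟨h1, h2, h3⟩
    exact ⟨fun i j ↦ h3 j i, fun i j ↦ (h1 i j).symm, fun i j ↦ h1 j i, fun i j ↦ h2 j i⟩

/-- The spin representation of `so(5)`, sending the infinitesimal rotation in the plane `i j` to
`γ i * γ j / 2`, where the `γ i` are the Dirac matrices
`1 ⊗ σ₁, 1 ⊗ σ₃, σ₁ ⊗ σ₂, σ₂ ⊗ σ₂, σ₃ ⊗ σ₂`. -/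
noncomputable def spinMatrix (X : Matrix (Fin 5) (Fin 5) ℂ) :
    Matrix (Fin 2 ⊕ Fin 2) (Fin 2 ⊕ Fin 2) ℂ :=
  (1 / 2 : ℂ) • fromBlocks
    !![Complex.I * (X 0 4 + X 2 3), -X 0 1 - Complex.I * X 1 4;
      X 0 1 - Complex.I * X 1 4, Complex.I * (X 2 3 - X 0 4)]
    !![Complex.I * (X 0 2 + X 3 4) + X 0 3 - X 2 4, -(Complex.I * X 1 2) - X 1 3;
      -(Complex.I * X 1 2) - X 1 3, Complex.I * (X 3 4 - X 0 2) - X 0 3 - X 2 4]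
    !![Complex.I * (X 0 2 + X 3 4) - X 0 3 + X 2 4, -(Complex.I * X 1 2) + X 1 3;
      -(Complex.I * X 1 2) + X 1 3, Complex.I * (X 3 4 - X 0 2) + X 0 3 + X 2 4]
    !![-(Complex.I * (X 0 4 + X 2 3)), -X 0 1 + Complex.I * X 1 4;
      X 0 1 + Complex.I * X 1 4, Complex.I * (X 0 4 - X 2 3)]

/-- The upper triangular part of the inverse of the spin representation. -/
noncomputable def vectorUpper (M : Matrix (Fin 2 ⊕ Fin 2) (Fin 2 ⊕ Fin 2) ℂ) :
    Matrix (Fin 5) (Fin 5) ℂ :=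
  let a := M.toBlocks₁₁
  let b := M.toBlocks₁₂
  let c := M.toBlocks₂₁
  !![0, a 1 0 - a 0 1, -(Complex.I / 2) * (b 0 0 - b 1 1 + c 0 0 - c 1 1),
      (b 0 0 - b 1 1 - c 0 0 + c 1 1) / 2, -Complex.I * (a 0 0 - a 1 1);
    0, 0, Complex.I * (b 0 1 + c 0 1), c 0 1 - b 0 1, Complex.I * (a 0 1 + a 1 0);
    0, 0, 0, -Complex.I * (a 0 0 + a 1 1), (c 0 0 + c 1 1 - b 0 0 - b 1 1) / 2;
    0, 0, 0, 0, -(Complex.I / 2) * (b 0 0 + b 1 1 + c 0 0 + c 1 1);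
    0, 0, 0, 0, 0]

/-- The inverse of the spin representation. -/
noncomputable def vectorMatrix (M : Matrix (Fin 2 ⊕ Fin 2) (Fin 2 ⊕ Fin 2) ℂ) :
    Matrix (Fin 5) (Fin 5) ℂ :=
  vectorUpper M - (vectorUpper M)ᵀ

theorem spinMatrix_mem_sp (X : Matrix (Fin 5) (Fin 5) ℂ) :
    spinMatrix X ∈ LieAlgebra.Symplectic.sp (Fin 2) ℂ := by
  rw [LieAlgebra.Symplectic.mem_sp_iff_apply]
  refine ⟨fun i j ↦ ?_, fun i j ↦ ?_, fun i j ↦ ?_⟩ <;> fin_cases i <;> fin_cases j <;>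
    simp [spinMatrix] <;> ring

theorem spinMatrix_add (X Y : Matrix (Fin 5) (Fin 5) ℂ) :
    spinMatrix (X + Y) = spinMatrix X + spinMatrix Y := by
  rw [spinMatrix, spinMatrix, spinMatrix, ← smul_add, fromBlocks_add]
  congr 2 <;> ext i j <;> fin_cases i <;> fin_cases j <;> simp <;> ring

theorem spinMatrix_smul (r : ℂ) (X : Matrix (Fin 5) (Fin 5) ℂ) :
    spinMatrix (r • X) = r • spinMatrix X := by
  rw [spinMatrix, spinMatrix, smul_comm, fromBlocks_smul]
  ext (i | i) (j | j) <;> fin_cases i <;> fin_cases j <;> simp <;> ring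

theorem vectorMatrix_spinMatrix {X : Matrix (Fin 5) (Fin 5) ℂ} (hX : Xᵀ = -X) :
    vectorMatrix (spinMatrix X) = X := by
  have h : ∀ i j, X j i = -X i j := fun i j ↦ congrFun (congrFun hX i) j
  have hd : ∀ i, X i i = 0 := fun i ↦ self_eq_neg.1 (h i i)
  ext i j
  fin_cases i <;> fin_cases j <;>
    simp [vectorMatrix, vectorUpper, spinMatrix, toBlocks₁₁, toBlocks₁₂, toBlocks₂₁, hd,
      h 0 1, h 0 2, h 0 3, h 0 4, h 1 2, h 1 3, h 1 4, h 2 3, h 2 4, h 3 4] <;>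
    ring_nf <;> simp

theorem spinMatrix_vectorMatrix {M : Matrix (Fin 2 ⊕ Fin 2) (Fin 2 ⊕ Fin 2) ℂ}
    (hM : M ∈ LieAlgebra.Symplectic.sp (Fin 2) ℂ) : spinMatrix (vectorMatrix M) = M := by
  obtain ⟨h1, h2, h3⟩ := LieAlgebra.Symplectic.mem_sp_iff_apply.1 hM
  have h2' := h2 1 0
  have h3' := h3 1 0
  ext (i | i) (j | j) <;> fin_cases i <;> fin_cases j <;>
    simp [vectorMatrix, vectorUpper, spinMatrix, toBlocks₁₁, toBlocks₁₂, toBlocks₂₁, h1, h2',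
      h3'] <;>
    ring_nf <;> simp <;> ring

-- The Clifford relations give `γ i * γ j / 2` the brackets of the infinitesimal rotations.
-- Skew-symmetry leaves upper triangular coordinates, in which this is a polynomial identity for
-- each entry.
set_option maxHeartbeats 2000000 in
theorem spinMatrix_lie {X Y : Matrix (Fin 5) (Fin 5) ℂ} (hX : Xᵀ = -X) (hY : Yᵀ = -Y) :
    spinMatrix (X * Y - Y * X) = spinMatrix X * spinMatrix Y - spinMatrix Y * spinMatrix X := by
  have h : ∀ i j, X j i = -X i j := fun i j ↦ congrFun (congrFun hX i) j
  have hd : ∀ i, X i i = 0 := fun i ↦ self_eq_neg.1 (h i i)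
  have h' : ∀ i j, Y j i = -Y i j := fun i j ↦ congrFun (congrFun hY i) j
  have hd' : ∀ i, Y i i = 0 := fun i ↦ self_eq_neg.1 (h' i i)
  ext (i | i) (j | j) <;> fin_cases i <;> fin_cases j <;>
    simp [spinMatrix, Matrix.mul_apply, Fin.sum_univ_five, hd, hd',
      h 0 1, h 0 2, h 0 3, h 1 2, h 1 3, h 1 4, h 2 3, h 2 4, h 3 4,
      h' 0 1, h' 0 2, h' 0 3, h' 1 2, h' 1 3, h' 1 4, h' 2 3, h' 2 4, h' 3 4] <;>
    ring_nf <;> simp <;> ring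

theorem vectorMatrix_transpose (M : Matrix (Fin 2 ⊕ Fin 2) (Fin 2 ⊕ Fin 2) ℂ) :
    (vectorMatrix M)ᵀ = -vectorMatrix M := by
  rw [vectorMatrix, transpose_sub, transpose_transpose, neg_sub]

/-- The exceptional isomorphism `so(5, ℂ) ≅ sp(4, ℂ)`. -/
noncomputable def soFiveEquiv :
    LieAlgebra.Orthogonal.so (Fin 5) ℂ ≃ₗ⁅ℂ⁆ LieAlgebra.Symplectic.sp (Fin 2) ℂ where
  toFun X := ⟨spinMatrix X.1, spinMatrix_mem_sp _⟩
  map_add' _ _ := Subtype.ext (spinMatrix_add _ _)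
  map_smul' _ _ := Subtype.ext (spinMatrix_smul _ _)
  map_lie' {X Y} := Subtype.ext (spinMatrix_lie ((LieAlgebra.Orthogonal.mem_so _ _ _).1 X.2)
    ((LieAlgebra.Orthogonal.mem_so _ _ _).1 Y.2))
  invFun M := ⟨vectorMatrix M.1, (LieAlgebra.Orthogonal.mem_so _ _ _).2 (vectorMatrix_transpose _)⟩
  left_inv X := Subtype.ext (vectorMatrix_spinMatrix ((LieAlgebra.Orthogonal.mem_so _ _ _).1 X.2))
  right_inv M := Subtype.ext (spinMatrix_vectorMatrix M.2)

theorem spinMatrix_map_conjTranspose (X : Matrix (Fin 5) (Fin 5) ℝ) :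
    (spinMatrix (X.map Complex.ofRealHom))ᴴ = -spinMatrix (X.map Complex.ofRealHom) := by
  ext (i | i) (j | j) <;> fin_cases i <;> fin_cases j <;>
    simp [spinMatrix] <;> ring

/-- Makes the inverse restrict to real forms: being skew-Hermitian and symplectic forces the
coordinates in `vectorUpper` to be real. -/
theorem vectorMatrix_map_star {M : Matrix (Fin 2 ⊕ Fin 2) (Fin 2 ⊕ Fin 2) ℂ}
    (hM : M ∈ compactSp 2) : (vectorMatrix M).map star = vectorMatrix M := by
  obtain ⟨-, h2, h3⟩ := LieAlgebra.Symplectic.mem_sp_iff_apply.1 hM.1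
  have h : ∀ i j, (starRingEnd ℂ) (M j i) = -M i j := fun i j ↦ congrFun (congrFun hM.2 i) j
  have hu : (vectorUpper M).map star = vectorUpper M := by
    ext i j
    fin_cases i <;> fin_cases j <;>
      simp [vectorUpper, toBlocks₁₁, toBlocks₁₂, toBlocks₂₁, h, h2 1 0, h3 1 0,
        map_ofNat (starRingEnd ℂ) 2] <;> ring
  rw [vectorMatrix, Matrix.map_sub _ star_sub, transpose_map, hu]

theorem vectorMatrix_map_re {M : Matrix (Fin 2 ⊕ Fin 2) (Fin 2 ⊕ Fin 2) ℂ}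
    (hM : M ∈ compactSp 2) :
    ((vectorMatrix M).map Complex.re).map Complex.ofRealHom = vectorMatrix M := by
  ext i j
  exact Complex.conj_eq_iff_re.1 (congrFun (congrFun (vectorMatrix_map_star hM) i) j)

theorem map_ofReal_transpose_eq_neg {X : Matrix (Fin 5) (Fin 5) ℝ} (hX : Xᵀ = -X) :
    (X.map Complex.ofRealHom)ᵀ = -X.map Complex.ofRealHom := by
  rw [← transpose_map, hX]
  ext i j
  simp

/-- The exceptional isomorphism of the compact real forms of `so(5)` and `sp(2)`. -/
noncomputable def soFiveEquivCompact :
    LieAlgebra.Orthogonal.so (Fin 5) ℝ ≃ₗ⁅ℝ⁆ compactSp 2 where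
  toFun X := ⟨spinMatrix (X.1.map Complex.ofRealHom), spinMatrix_mem_sp _,
    spinMatrix_map_conjTranspose _⟩
  map_add' X Y := Subtype.ext <| by
    change spinMatrix ((X.1 + Y.1).map Complex.ofRealHom) = _
    rw [Matrix.map_add _ (map_add _), spinMatrix_add]
    rfl
  map_smul' r X := Subtype.ext <| by
    change spinMatrix ((r • X.1).map Complex.ofRealHom) =
      r • spinMatrix (X.1.map Complex.ofRealHom)
    have e : (r • X.1).map Complex.ofRealHom = (r : ℂ) • X.1.map Complex.ofRealHom := by
      ext; simp
    rw [e, spinMatrix_smul]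
    ext; simp
  map_lie' {X Y} := Subtype.ext <| by
    change spinMatrix ((X.1 * Y.1 - Y.1 * X.1).map Complex.ofRealHom) = _
    rw [Matrix.map_sub _ (map_sub _), Matrix.map_mul, Matrix.map_mul]
    exact spinMatrix_lie (map_ofReal_transpose_eq_neg ((LieAlgebra.Orthogonal.mem_so _ _ _).1 X.2))
      (map_ofReal_transpose_eq_neg ((LieAlgebra.Orthogonal.mem_so _ _ _).1 Y.2))
  invFun M := ⟨(vectorMatrix M.1).map Complex.re, (LieAlgebra.Orthogonal.mem_so _ _ _).2 <| by
    rw [← transpose_map, vectorMatrix_transpose]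
    ext i j
    simp⟩
  left_inv X := Subtype.ext <| by
    change (vectorMatrix (spinMatrix (X.1.map Complex.ofRealHom))).map Complex.re = X.1
    rw [vectorMatrix_spinMatrix
      (map_ofReal_transpose_eq_neg ((LieAlgebra.Orthogonal.mem_so _ _ _).1 X.2))]
    ext i j
    simp
  right_inv M := Subtype.ext <| by
    change spinMatrix (((vectorMatrix M.1).map Complex.re).map Complex.ofRealHom) = M.1
    rw [vectorMatrix_map_re M.2, spinMatrix_vectorMatrix M.2.1]

/-! ### Extension by zero -/

section ExtendByZero

variable {m : ℕ}

/-- Orthonormality of the columns makes extension by zero multiplicative and lets compression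
recover the operator. -/
theorem coordIncl_transpose_mul (m : ℕ) : (coordIncl m)ᵀ * coordIncl m = 1 := by
  have hinj : Function.Injective (Sum.map Fin.castSucc Fin.castSucc :
      Fin m ⊕ Fin m → Fin (m + 1) ⊕ Fin (m + 1)) :=
    Sum.map_injective.2 ⟨Fin.castSucc_injective m, Fin.castSucc_injective m⟩
  ext i j
  simp only [coordIncl, Matrix.mul_apply, transpose_apply, submatrix_apply, id, Matrix.one_apply]
  simp [hinj.eq_iff, eq_comm]

theorem coordIncl_conjTranspose (m : ℕ) : (coordIncl m)ᴴ = (coordIncl m)ᵀ := by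
  ext i j
  simp only [coordIncl, conjTranspose_apply, transpose_apply, submatrix_apply, Matrix.one_apply]
  split_ifs <;> simp

/-- The inclusion acts alike on both halves, so it respects the pairing of coordinates; the omitted
last pair spans a symplectic plane. -/
theorem J_mul_coordIncl (m : ℕ) :
    Matrix.J (Fin (m + 1)) ℂ * coordIncl m = coordIncl m * Matrix.J (Fin m) ℂ := by
  obtain ⟨c, hc⟩ : ∃ c : Matrix (Fin (m + 1)) (Fin m) ℂ, coordIncl m = fromBlocks c 0 0 c := by
    refine ⟨(1 : Matrix (Fin (m + 1)) (Fin (m + 1)) ℂ).submatrix id Fin.castSucc, ?_⟩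
    ext (i | i) (j | j) <;> simp [coordIncl, Matrix.one_apply]
  rw [hc, Matrix.J, Matrix.J, fromBlocks_multiply, fromBlocks_multiply]
  simp

theorem coordIncl_transpose_mul_J (m : ℕ) :
    (coordIncl m)ᵀ * Matrix.J (Fin (m + 1)) ℂ = Matrix.J (Fin m) ℂ * (coordIncl m)ᵀ := by
  have := congrArg transpose (J_mul_coordIncl m)
  rw [transpose_mul, transpose_mul, Matrix.J_transpose, Matrix.J_transpose, Matrix.mul_neg,
    Matrix.neg_mul] at this
  exact neg_injective this

theorem extendByZero_mul (A B : Matrix (Fin m ⊕ Fin m) (Fin m ⊕ Fin m) ℂ) :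
    extendByZero (A * B) = extendByZero A * extendByZero B := by
  simp only [extendByZero, Matrix.mul_assoc]
  rw [← Matrix.mul_assoc (coordIncl m)ᵀ (coordIncl m), coordIncl_transpose_mul, Matrix.one_mul]

theorem extendByZero_add (A B : Matrix (Fin m ⊕ Fin m) (Fin m ⊕ Fin m) ℂ) :
    extendByZero (A + B) = extendByZero A + extendByZero B := by
  rw [extendByZero, Matrix.mul_add, Matrix.add_mul]; rfl

theorem extendByZero_sub (A B : Matrix (Fin m ⊕ Fin m) (Fin m ⊕ Fin m) ℂ) :
    extendByZero (A - B) = extendByZero A - extendByZero B := by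
  rw [extendByZero, Matrix.mul_sub, Matrix.sub_mul]; rfl

theorem extendByZero_neg (A : Matrix (Fin m ⊕ Fin m) (Fin m ⊕ Fin m) ℂ) :
    extendByZero (-A) = -extendByZero A := by
  rw [extendByZero, Matrix.mul_neg, Matrix.neg_mul]; rfl

theorem extendByZero_smul (r : ℂ) (A : Matrix (Fin m ⊕ Fin m) (Fin m ⊕ Fin m) ℂ) :
    extendByZero (r • A) = r • extendByZero A := by
  rw [extendByZero, Matrix.mul_smul, Matrix.smul_mul]; rfl

theorem extendByZero_injective : Function.Injective (extendByZero (m := m)) := by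
  have h : ∀ A : Matrix (Fin m ⊕ Fin m) (Fin m ⊕ Fin m) ℂ,
      (coordIncl m)ᵀ * extendByZero A * coordIncl m = A := fun A ↦ by
    rw [extendByZero, Matrix.mul_assoc, Matrix.mul_assoc, coordIncl_transpose_mul, Matrix.mul_one,
      ← Matrix.mul_assoc, coordIncl_transpose_mul, Matrix.one_mul]
  intro A B hAB
  rw [← h A, hAB, h B]

theorem extendByZero_transpose (A : Matrix (Fin m ⊕ Fin m) (Fin m ⊕ Fin m) ℂ) :
    (extendByZero A)ᵀ = extendByZero Aᵀ := by
  rw [extendByZero, transpose_mul, transpose_mul, transpose_transpose, extendByZero,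
    Matrix.mul_assoc]

theorem extendByZero_conjTranspose (A : Matrix (Fin m ⊕ Fin m) (Fin m ⊕ Fin m) ℂ) :
    (extendByZero A)ᴴ = extendByZero Aᴴ := by
  rw [extendByZero, conjTranspose_mul, conjTranspose_mul, ← coordIncl_conjTranspose,
    conjTranspose_conjTranspose, extendByZero, Matrix.mul_assoc, coordIncl_conjTranspose]

theorem extendByZero_mem_sp {A : Matrix (Fin m ⊕ Fin m) (Fin m ⊕ Fin m) ℂ}
    (hA : A ∈ LieAlgebra.Symplectic.sp (Fin m) ℂ) :
    extendByZero A ∈ LieAlgebra.Symplectic.sp (Fin (m + 1)) ℂ := by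
  rw [LieAlgebra.Symplectic.mem_sp] at hA ⊢
  rw [extendByZero_transpose, ← extendByZero_neg, extendByZero, extendByZero, Matrix.mul_assoc,
    coordIncl_transpose_mul_J, ← Matrix.mul_assoc, Matrix.mul_assoc (coordIncl m), hA,
    ← Matrix.mul_assoc, ← Matrix.mul_assoc, ← Matrix.mul_assoc, J_mul_coordIncl]

/-- The standard inclusion of `sp(2m, ℂ)` in `sp(2m + 2, ℂ)`. -/
def spInclusion (m : ℕ) :
    LieAlgebra.Symplectic.sp (Fin m) ℂ →ₗ⁅ℂ⁆ LieAlgebra.Symplectic.sp (Fin (m + 1)) ℂ where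
  toFun A := ⟨extendByZero A.1, extendByZero_mem_sp A.2⟩
  map_add' _ _ := Subtype.ext (extendByZero_add _ _)
  map_smul' _ _ := Subtype.ext (extendByZero_smul _ _)
  map_lie' {A B} := Subtype.ext <| by
    change extendByZero (A.1 * B.1 - B.1 * A.1) = _
    rw [extendByZero_sub, extendByZero_mul, extendByZero_mul]
    rfl

/-- The standard inclusion of the compact Lie algebra `sp(m)` in `sp(m + 1)`. -/
def compactSpInclusion (m : ℕ) : compactSp m →ₗ⁅ℝ⁆ compactSp (m + 1) where
  toFun A := ⟨extendByZero A.1, extendByZero_mem_sp A.2.1, by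
    rw [extendByZero_conjTranspose, A.2.2, extendByZero_neg]⟩
  map_add' _ _ := Subtype.ext (extendByZero_add _ _)
  map_smul' r A := Subtype.ext <| by
    have e : ∀ {n : ℕ} (B : Matrix (Fin n ⊕ Fin n) (Fin n ⊕ Fin n) ℂ), r • B = (r : ℂ) • B :=
      fun B ↦ by ext; simp
    change extendByZero (r • A.1) = r • extendByZero A.1
    rw [e, e, extendByZero_smul]
  map_lie' {A B} := Subtype.ext <| by
    change extendByZero (A.1 * B.1 - B.1 * A.1) = _
    rw [extendByZero_sub, extendByZero_mul, extendByZero_mul]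
    rfl

end ExtendByZero

theorem mainTheorem1 :
    (∀ k : ℕ, 3 ≤ k →
      -- complex Lie algebras
      (¬ ∃ f : LieAlgebra.Orthogonal.so (Fin (2 * k + 1)) ℂ →ₗ⁅ℂ⁆
          LieAlgebra.Symplectic.sp (Fin (k + 1)) ℂ, Function.Injective f) ∧
      -- compact real forms
      (¬ ∃ f : LieAlgebra.Orthogonal.so (Fin (2 * k + 1)) ℝ →ₗ⁅ℝ⁆
          compactSp (k + 1), Function.Injective f)) ∧
    -- the case `k = 2`, complex
    (∃ (e : LieAlgebra.Orthogonal.so (Fin 5) ℂ ≃ₗ⁅ℂ⁆ LieAlgebra.Symplectic.sp (Fin 2) ℂ)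
        (f : LieAlgebra.Orthogonal.so (Fin 5) ℂ →ₗ⁅ℂ⁆ LieAlgebra.Symplectic.sp (Fin 3) ℂ),
      Function.Injective f ∧
        ∀ x, (f x : Matrix (Fin 3 ⊕ Fin 3) (Fin 3 ⊕ Fin 3) ℂ) =
          extendByZero (e x : Matrix (Fin 2 ⊕ Fin 2) (Fin 2 ⊕ Fin 2) ℂ)) ∧
    -- the case `k = 2`, compact
    (∃ (e : LieAlgebra.Orthogonal.so (Fin 5) ℝ ≃ₗ⁅ℝ⁆ compactSp 2)
        (f : LieAlgebra.Orthogonal.so (Fin 5) ℝ →ₗ⁅ℝ⁆ compactSp 3),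
      Function.Injective f ∧
        ∀ x, (f x : Matrix (Fin 3 ⊕ Fin 3) (Fin 3 ⊕ Fin 3) ℂ) =
          extendByZero (e x : Matrix (Fin 2 ⊕ Fin 2) (Fin 2 ⊕ Fin 2) ℂ)) := by
  refine ⟨fun k hk ↦ ⟨LieAlgebra.Orthogonal.not_exists_injective_sp hk,
    LieAlgebra.Orthogonal.not_exists_injective_compactSp hk⟩,
    ⟨soFiveEquiv, (spInclusion 2).comp soFiveEquiv.toLieHom, ?_, fun _ ↦ rfl⟩,
    ⟨soFiveEquivCompact, (compactSpInclusion 2).comp soFiveEquivCompact.toLieHom, ?_, fun _ ↦ rfl⟩⟩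
  · intro x y hxy
    exact soFiveEquiv.injective (Subtype.ext (extendByZero_injective (congrArg Subtype.val hxy)))
  · intro x y hxy
    exact soFiveEquivCompact.injective
      (Subtype.ext (extendByZero_injective (congrArg Subtype.val hxy)))
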